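/- Let $(\Lambda,\mathfrak m,k)$ be a Noetherian local domain that is $\mathfrak m$-adically complete (and separated). Assume that $\Lambda$ admits a non-trivial valuation compatible with the $\mathfrak m$-adic topology, i.e. a function $\nu:\Lambda\to\mathbb N\cup\{\infty\}$ such that - $\nu(ab)=\nu(a)+\nu(b)$ and $\nu(a+b)\ge\min\{\nu(a),\nu(b)\}$ for all $a,b\in\Lambda$, $\nu^{-1}(\infty)=\{0\}$, and $\nu(\Lambda)\setminus\{0,\infty\}\neq\emptyset$; - the $\mathfrak m$-adic topology on $\Lambda$ coincides with the linear topology in which the ideals $\{a\in\Lambda\mid\nu(a)\ge n\}$, $n\in\mathbb N$, form a basis of neighbourhoods of $0$. Let $\mathrm{Art}_\Lambda$ be the category of Artinian local $\Lambda$-algebras with residue field $k$ (that is, the map from $\Lambda$ to the residue field is surjective, hence identifies that residue field with $k$) and $\Lambda$-algebra homomorphisms. Let $F:\mathrm{Art}_\Lambda\to\mathbf{Set}$ be a deformation functor: $F(k)$ is a singleton, and, for all morphisms $A'\to A\leftarrow A''$ in $\mathrm{Art}_\Lambda$, the canonical map $$F(A'\times_A A'')\longrightarrow F(A')\times_{F(A)}F(A'')$$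 is - (H1) surjective whenever $A''\to A$ is a small extension, i.e. a surjection whose kernel is a non-zero principal ideal $(t)$ with $\mathfrak m_{A''}t=0$; - (H2) bijective whenever $A''\to A$ is the projection $k[t]/(t^2)\to k$. Assume that the tangent space $F(k[t]/(t^2))$ is a finite-dimensional $k$-vector space. Here addition is the map induced by $k\times k\to k$, $(a,b)\mapsto a+b$, via $F(k[t]/(t^2))\times F(k[t]/(t^2))=F\big(k[t]/(t^2)\times_k k[t]/(t^2)\big)$, and multiplication by $c\in k$ is induced by $t\mapsto ct$. If, for every integer $\ell\ge1$, the function $F(\Lambda/\mathfrak m^{\ell+1})\to F(\Lambda/\mathfrak m^{\ell})$ induced by the canonical projection $\Lambda/\mathfrak m^{\ell+1}\to\Lambda/\mathfrak m^{\ell}$ is surjective, then $F$ is smooth: the unique natural transformation $F\to h_\Lambda=\mathrm{Hom}_\Lambda(\Lambda,-)$ is smooth, i.e. for every surjection $B\to A$ in $\mathrm{Art}_\Lambda$ the map $F(B)\to F(A)\times_{h_\Lambda(A)}h_\Lambda(B)$ is surjective. -/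

import Mathlib

open CategoryTheory IsLocalRing

universe w u

namespace Deformation

noncomputable section

/-! ### Valuations -/

/-- A non-trivial valuation on a ring, with values in `ℕ ∪ {∞}`. -/
structure IsNontrivialValuation {R : Type u} [CommRing R] (ν : R → ℕ∞) : Prop where
  map_mul : ∀ a b : R, ν (a * b) = ν a + ν b
  map_add : ∀ a b : R, min (ν a) (ν b) ≤ ν (a + b)
  preimage_top : ν ⁻¹' {⊤} = {0}
  nontrivial : (Set.range ν \ {0, ⊤}).Nonempty

namespace IsNontrivialValuation

variable {R : Type u} [CommRing R] {ν : R → ℕ∞}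

lemma map_zero (hν : IsNontrivialValuation ν) : ν 0 = ⊤ := by
  have h : (0 : R) ∈ ν ⁻¹' {⊤} := by rw [hν.preimage_top]; rfl
  exact h

/-- The ideal `{a | ν a ≥ n}`. -/
def filtration (hν : IsNontrivialValuation ν) (n : ℕ) : Ideal R where
  carrier := {a | (n : ℕ∞) ≤ ν a}
  add_mem' {a b} ha hb := (le_min ha hb).trans (hν.map_add a b)
  zero_mem' := by simp [hν.map_zero]
  smul_mem' c a ha := by
    have h : (n : ℕ∞) ≤ ν a := ha
    change (n : ℕ∞) ≤ ν (c * a)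
    rw [hν.map_mul]
    exact h.trans le_add_self

lemma filtration_basis (hν : IsNontrivialValuation ν) :
    SubmodulesRingBasis hν.filtration where
  inter i j := by
    refine ⟨max i j, fun a ha => ?_⟩
    have h : ((max i j : ℕ) : ℕ∞) ≤ ν a := ha
    exact ⟨(Nat.cast_le.2 (le_max_left i j)).trans h, (Nat.cast_le.2 (le_max_right i j)).trans h⟩
  leftMul a i := by
    refine ⟨i, ?_⟩
    rintro _ ⟨x, hx, rfl⟩
    exact (hν.filtration i).mul_mem_left a hx
  mul i := by
    refine ⟨i, ?_⟩
    rintro _ ⟨x, _, y, hy, rfl⟩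
    exact (hν.filtration i).mul_mem_left x hy

/-- The linear topology in which the ideals `{a | ν a ≥ n}`, `n ∈ ℕ`, form a basis of
neighbourhoods of `0`. -/
@[reducible]
def topology (hν : IsNontrivialValuation ν) : TopologicalSpace R :=
  hν.filtration_basis.topology

end IsNontrivialValuation

/-- `ν` is a non-trivial valuation on the local ring `R` whose associated linear topology is the
`𝔪`-adic topology. -/
def IsCompatibleValuation {R : Type u} [CommRing R] [IsLocalRing R] (ν : R → ℕ∞) : Prop :=
  ∃ hν : IsNontrivialValuation ν, (maximalIdeal R).adicTopology = hν.topology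

/-! ### The category of Artinian local algebras -/

section Art

variable (Λ : Type u) [CommRing Λ]

/-- A `Λ`-algebra is Artinian local with the same residue field as `Λ` if it is an Artinian local
ring `A` such that `Λ → A / 𝔪_A` is surjective. If `Λ` is local, then the kernel of this map is
automatically the maximal ideal of `Λ`, so that it identifies the residue field of `A` with that
of `Λ`; in particular `Λ → A` is local, and all `Λ`-algebra homomorphisms between two such algebras
are local and compatible with the projections onto the residue field of `Λ`. -/
def IsArtAlg : ObjectProperty (CommAlgCat.{u} Λ) := fun A =>
  ∃ _ : IsLocalRing A, IsArtinianRing A ∧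
    Function.Surjective (fun x : Λ => residue A (algebraMap Λ A x))

/-- The category of Artinian local `Λ`-algebras with the same residue field as `Λ`. -/
abbrev Art : Type (u + 1) := (IsArtAlg Λ).FullSubcategory

variable {Λ}

instance (A : Art Λ) : IsLocalRing A.obj := A.property.choose

instance (A : Art Λ) : IsArtinianRing A.obj := A.property.choose_spec.1

namespace Art

/-- The object of `Art Λ` given by an unbundled algebra. -/
def of (A : Type u) [CommRing A] [Algebra Λ A] [IsLocalRing A] [IsArtinianRing A]
    (h : Function.Surjective (fun x : Λ => residue A (algebraMap Λ A x))) : Art Λ :=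
  ⟨CommAlgCat.of Λ A, ‹IsLocalRing A›, ‹IsArtinianRing A›, h⟩

/-- The `Λ`-algebra homomorphism underlying a morphism of `Art Λ`. -/
def toAlgHom {A B : Art Λ} (f : A ⟶ B) : A.obj →ₐ[Λ] B.obj := f.hom.hom

/-- The morphism of `Art Λ` given by a `Λ`-algebra homomorphism. -/
def ofAlgHom {A B : Art Λ} (f : A.obj →ₐ[Λ] B.obj) : A ⟶ B :=
  ObjectProperty.homMk (CommAlgCat.ofHom f)

lemma hom_ext {A B : Art Λ} {f g : A ⟶ B} (h : ∀ x, toAlgHom f x = toAlgHom g x) : f = g :=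
  ObjectProperty.hom_ext _ (CommAlgCat.hom_ext (AlgHom.ext h))

@[simp] lemma toAlgHom_ofAlgHom {A B : Art Λ} (f : A.obj →ₐ[Λ] B.obj) :
    toAlgHom (ofAlgHom f : A ⟶ B) = f := rfl

@[simp] lemma toAlgHom_comp {A B C : Art Λ} (f : A ⟶ B) (g : B ⟶ C) (x : A.obj) :
    toAlgHom (f ≫ g) x = toAlgHom g (toAlgHom f x) := rfl

@[simp] lemma toAlgHom_id {A : Art Λ} (x : A.obj) : toAlgHom (𝟙 A) x = x := rfl

end Art

/-- A surjection in `Art Λ`. -/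
def IsSurjection {B A : Art Λ} (p : B ⟶ A) : Prop := Function.Surjective (Art.toAlgHom p)

/-- A small extension: a surjection `B → A` whose kernel is a non-zero principal ideal `(t)` with
`𝔪_B t = 0`. -/
def IsSmallExtension {B A : Art Λ} (p : B ⟶ A) : Prop :=
  IsSurjection p ∧ ∃ t : B.obj, t ≠ 0 ∧ RingHom.ker (Art.toAlgHom p) = Ideal.span {t} ∧
    ∀ x ∈ maximalIdeal B.obj, x * t = 0

end Art

/-! ### Particular objects: `k`, `Λ / 𝔪 ^ n`, and `k[V]` -/

section Objects

variable (Λ : Type u) [CommRing Λ] [IsLocalRing Λ]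

/-- The residue field `k` of `Λ` as an object of `Art Λ`. -/
def resField : Art Λ :=
  Art.of (ResidueField Λ) (by
    intro y
    obtain ⟨z, rfl⟩ := residue_surjective y
    obtain ⟨x, rfl⟩ := residue_surjective z
    exact ⟨x, rfl⟩)

section PowQuot

instance nontrivial_quotPow (n : ℕ) [NeZero n] : Nontrivial (Λ ⧸ maximalIdeal Λ ^ n) :=
  Ideal.Quotient.nontrivial_iff.2
    (ne_top_of_le_ne_top (maximalIdeal.isMaximal Λ).ne_top (Ideal.pow_le_self (NeZero.ne n)))

instance isLocalRing_quotPow (n : ℕ) [NeZero n] : IsLocalRing (Λ ⧸ maximalIdeal Λ ^ n) :=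
  IsLocalRing.of_surjective' (Ideal.Quotient.mk _) Ideal.Quotient.mk_surjective

variable [IsNoetherianRing Λ]

instance isArtinianRing_quotPow (n : ℕ) [NeZero n] : IsArtinianRing (Λ ⧸ maximalIdeal Λ ^ n) := by
  rw [isArtinianRing_iff_isNilpotent_maximalIdeal]
  refine ⟨n, ?_⟩
  have h : maximalIdeal (Λ ⧸ maximalIdeal Λ ^ n) =
      (maximalIdeal Λ).map (Ideal.Quotient.mk (maximalIdeal Λ ^ n)) := by
    refine le_antisymm (fun x hx => ?_) (((local_hom_TFAE _).out 0 2).1 ?_)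
    · obtain ⟨y, rfl⟩ := Ideal.Quotient.mk_surjective x
      refine Ideal.mem_map_of_mem _ ?_
      rw [mem_maximalIdeal, mem_nonunits_iff] at hx ⊢
      exact fun hy => hx (hy.map _)
    · exact IsLocalHom.of_surjective _ Ideal.Quotient.mk_surjective
  rw [h, ← Ideal.map_pow, Ideal.map_quotient_self]
  rfl

/-- The object `Λ / 𝔪 ^ n` of `Art Λ`, for `n ≠ 0`. -/
def quotPow (n : ℕ) [NeZero n] : Art Λ :=
  Art.of (Λ ⧸ maximalIdeal Λ ^ n) (by
    intro y
    obtain ⟨z, rfl⟩ := residue_surjective y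
    obtain ⟨x, rfl⟩ := Ideal.Quotient.mk_surjective z
    exact ⟨x, rfl⟩)

/-- The canonical projection `Λ / 𝔪 ^ (n + 1) → Λ / 𝔪 ^ n`. -/
def quotPowProj (n : ℕ) [NeZero n] : quotPow Λ (n + 1) ⟶ quotPow Λ n :=
  Art.ofAlgHom (A := quotPow Λ (n + 1)) (B := quotPow Λ n)
    (Ideal.Quotient.factorₐ Λ (Ideal.pow_le_pow_right n.le_succ))

end PowQuot

section SqZero

variable (V : Type u) [AddCommGroup V] [Module (ResidueField Λ) V] [Module (ResidueField Λ)ᵐᵒᵖ V]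
  [IsCentralScalar (ResidueField Λ) V] [Module Λ V] [IsScalarTower Λ (ResidueField Λ) V]
  [IsScalarTower Λ (ResidueField Λ)ᵐᵒᵖ V]
  [Module.Finite (ResidueField Λ) V]

instance isLocalRing_sqZero : IsLocalRing (TrivSqZeroExt (ResidueField Λ) V) := by
  refine IsLocalRing.of_isUnit_or_isUnit_one_sub_self fun a => ?_
  rw [TrivSqZeroExt.isUnit_iff_isUnit_fst, TrivSqZeroExt.isUnit_iff_isUnit_fst]
  simpa using IsLocalRing.isUnit_or_isUnit_one_sub_self a.fst

instance isArtinianRing_sqZero : IsArtinianRing (TrivSqZeroExt (ResidueField Λ) V) := by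
  have h : Module.Finite (ResidueField Λ) (TrivSqZeroExt (ResidueField Λ) V) :=
    inferInstanceAs (Module.Finite (ResidueField Λ) (ResidueField Λ × V))
  exact isArtinian_of_tower (ResidueField Λ) inferInstance

/-- For a finite-dimensional `k`-vector space `V`, the object `k[V] = k ⊕ V` of `Art Λ`, in which
`V` is an ideal of square zero. -/
def sqZero : Art Λ :=
  Art.of (TrivSqZeroExt (ResidueField Λ) V) (by
    intro y
    obtain ⟨z, rfl⟩ := residue_surjective y
    obtain ⟨x, hx⟩ := residue_surjective z.fst
    refine ⟨x, ?_⟩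
    rw [← sub_eq_zero, ← map_sub, residue_eq_zero_iff, mem_maximalIdeal, mem_nonunits_iff,
      TrivSqZeroExt.isUnit_iff_isUnit_fst, TrivSqZeroExt.algebraMap_eq_inl',
      TrivSqZeroExt.fst_sub, TrivSqZeroExt.fst_inl, ← hx]
    simp [ResidueField.algebraMap_eq])

/-- The projection `k[V] → k`. -/
def sqZeroProj : sqZero Λ V ⟶ resField Λ :=
  Art.ofAlgHom (A := sqZero Λ V) (B := resField Λ)
    (TrivSqZeroExt.fstHom Λ (ResidueField Λ) V)

end SqZero

/-- The object `k[ε] = k[t] / (t ^ 2)` of `Art Λ`. -/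
abbrev dual : Art Λ := sqZero Λ (ResidueField Λ)

end Objects

/-! ### Deformation functors -/

section Functors

variable {Λ : Type u} [CommRing Λ]

/-- For a commutative square `p₁ ≫ f = p₂ ≫ g` in `Art Λ` with corner `P`, the canonical map
`F(P) → F(A') ×_{F(A)} F(A'')`. -/
def fiberComparison (F : Art Λ ⥤ Type w) {P A' A'' A : Art Λ} {p₁ : P ⟶ A'} {p₂ : P ⟶ A''}
    {f : A' ⟶ A} {g : A'' ⟶ A} (h : p₁ ≫ f = p₂ ≫ g) (x : F.obj P) :
    {y : F.obj A' × F.obj A'' // F.map f y.1 = F.map g y.2} :=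
  ⟨(F.map p₁ x, F.map p₂ x), by
    rw [← Functor.map_comp_apply, h, Functor.map_comp_apply]⟩

/-- A deformation functor on `Art Λ`: `F(k)` is a singleton, and `F` satisfies Schlessinger's
conditions (H1) and (H2) on the maps `F(A' ×_A A'') → F(A') ×_{F(A)} F(A'')`. -/
class IsDeformationFunctor [IsLocalRing Λ] (F : Art Λ ⥤ Type w) : Prop where
  /-- `F(k)` has exactly one element. -/
  singleton : Nonempty (Unique (F.obj (resField Λ)))
  /-- (H1): surjectivity if `A'' → A` is a small extension. -/
  h1 : ∀ {P A' A'' A : Art Λ} {p₁ : P ⟶ A'} {p₂ : P ⟶ A''} {f : A' ⟶ A} {g : A'' ⟶ A}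
    (h : IsPullback p₁ p₂ f g), IsSmallExtension g → Function.Surjective (fiberComparison F h.w)
  /-- (H2): bijectivity if `A'' → A` is `k[ε] → k`. -/
  h2 : ∀ {P A' : Art Λ} {p₁ : P ⟶ A'} {p₂ : P ⟶ dual Λ} {f : A' ⟶ resField Λ}
    (h : IsPullback p₁ p₂ f (sqZeroProj Λ (ResidueField Λ))),
    Function.Bijective (fiberComparison F h.w)

/-- A natural transformation `η : F ⟶ G` is smooth if `F(B) → F(A) ×_{G(A)} G(B)` is surjective for
every surjection `B → A`. -/
def IsSmoothTrans {F G : Art Λ ⥤ Type w} (η : F ⟶ G) : Prop :=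
  ∀ {B A : Art Λ} (p : B ⟶ A), IsSurjection p →
    Function.Surjective (fun x : F.obj B =>
      (⟨(F.map p x, η.app B x), NatTrans.naturality_apply η p x⟩ :
        {y : F.obj A × G.obj B // η.app A y.1 = G.map p y.2}))

variable (Λ) in
/-- The functor `h_Λ = Hom(Λ, -)` of `Λ`-algebra homomorphisms out of `Λ`. -/
def hBase : Art Λ ⥤ Type u :=
  (IsArtAlg Λ).ι ⋙ coyoneda.obj (Opposite.op (CommAlgCat.of Λ Λ))

/-- The unique natural transformation `F → h_Λ`; it sends every element of `F(A)` to the structure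
morphism `Λ → A`. The two functors are lifted to a common universe. -/
def toHBase (F : Art Λ ⥤ Type w) :
    F ⋙ uliftFunctor.{u, w} ⟶ hBase Λ ⋙ uliftFunctor.{w, u} where
  app A := TypeCat.ofHom fun _ => ULift.up (CommAlgCat.ofHom (Algebra.ofId Λ A.obj))
  naturality A B f := by
    ext x
    apply ULift.ext
    apply CommAlgCat.hom_ext
    exact Subsingleton.elim _ _

/-- A functor `F` is smooth if `F → h_Λ` is smooth. -/
def IsSmooth (F : Art Λ ⥤ Type w) : Prop := IsSmoothTrans (toHBase F)

end Functors

/-! ### The tangent space -/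

section SqZeroMaps

variable {Λ : Type u} [CommRing Λ] [IsLocalRing Λ]
variable {V W : Type u} [AddCommGroup V] [Module (ResidueField Λ) V] [Module (ResidueField Λ)ᵐᵒᵖ V]
  [IsCentralScalar (ResidueField Λ) V] [Module Λ V] [IsScalarTower Λ (ResidueField Λ) V]
  [IsScalarTower Λ (ResidueField Λ)ᵐᵒᵖ V]
  [Module.Finite (ResidueField Λ) V]
  [AddCommGroup W] [Module (ResidueField Λ) W] [Module (ResidueField Λ)ᵐᵒᵖ W]
  [IsCentralScalar (ResidueField Λ) W] [Module Λ W] [IsScalarTower Λ (ResidueField Λ) W]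
  [IsScalarTower Λ (ResidueField Λ)ᵐᵒᵖ W]
  [Module.Finite (ResidueField Λ) W]

/-- The morphism `k[V] → k[W]`, `a + v ↦ a + L v`, given by a linear map `L : V → W`. -/
def sqZeroMap (L : V →ₗ[ResidueField Λ] W) : sqZero Λ V ⟶ sqZero Λ W :=
  Art.ofAlgHom (A := sqZero Λ V) (B := sqZero Λ W)
    { (TrivSqZeroExt.map L).toRingHom with
      commutes' := fun r => by
        change TrivSqZeroExt.map L (algebraMap Λ (TrivSqZeroExt (ResidueField Λ) V) r) =
          algebraMap Λ (TrivSqZeroExt (ResidueField Λ) W) r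
        rw [TrivSqZeroExt.algebraMap_eq_inl', TrivSqZeroExt.algebraMap_eq_inl',
          TrivSqZeroExt.map_inl] }

lemma sqZeroMap_id : sqZeroMap (LinearMap.id : V →ₗ[ResidueField Λ] V) = 𝟙 _ :=
  Art.hom_ext fun x => DFunLike.congr_fun (TrivSqZeroExt.map_id (R' := ResidueField Λ) (M := V)) x

lemma sqZeroMap_proj (L : V →ₗ[ResidueField Λ] W) :
    sqZeroMap L ≫ sqZeroProj Λ W = sqZeroProj Λ V :=
  Art.hom_ext fun x => TrivSqZeroExt.fst_map L x

/-- The morphism `k → k[V]`. -/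
def sqZeroIncl (V : Type u) [AddCommGroup V] [Module (ResidueField Λ) V]
    [Module (ResidueField Λ)ᵐᵒᵖ V] [IsCentralScalar (ResidueField Λ) V] [Module Λ V]
    [IsScalarTower Λ (ResidueField Λ) V] [IsScalarTower Λ (ResidueField Λ)ᵐᵒᵖ V]
    [Module.Finite (ResidueField Λ) V] : resField Λ ⟶ sqZero Λ V :=
  Art.ofAlgHom (A := resField Λ) (B := sqZero Λ V)
    (TrivSqZeroExt.inlAlgHom Λ (ResidueField Λ) V)

lemma sqZeroMap_zero :
    sqZeroMap (0 : V →ₗ[ResidueField Λ] W) = sqZeroProj Λ V ≫ sqZeroIncl W := by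
  refine Art.hom_ext fun (x : TrivSqZeroExt (ResidueField Λ) V) => ?_
  change TrivSqZeroExt.map (0 : V →ₗ[ResidueField Λ] W) x = TrivSqZeroExt.inl x.fst
  ext <;> simp

lemma sqZeroMap_comp {U : Type u} [AddCommGroup U] [Module (ResidueField Λ) U]
    [Module (ResidueField Λ)ᵐᵒᵖ U] [IsCentralScalar (ResidueField Λ) U] [Module Λ U]
    [IsScalarTower Λ (ResidueField Λ) U] [IsScalarTower Λ (ResidueField Λ)ᵐᵒᵖ U]
    [Module.Finite (ResidueField Λ) U] (L : V →ₗ[ResidueField Λ] W) (M : W →ₗ[ResidueField Λ] U) :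
    sqZeroMap L ≫ sqZeroMap M = sqZeroMap (M ∘ₗ L) :=
  Art.hom_ext fun x => (DFunLike.congr_fun (TrivSqZeroExt.map_comp_map L M) x).symm

/-- The map into `k[V × W]` given by maps into `k[V]` and `k[W]` that agree in `k`. -/
def prodLift {T : Type u} [CommRing T] [Algebra Λ T]
    (a : T →ₐ[Λ] TrivSqZeroExt (ResidueField Λ) V) (b : T →ₐ[Λ] TrivSqZeroExt (ResidueField Λ) W)
    (h : ∀ x, (a x).fst = (b x).fst) : T →ₐ[Λ] TrivSqZeroExt (ResidueField Λ) (V × W) where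
  toFun x := TrivSqZeroExt.inl (a x).fst + TrivSqZeroExt.inr ((a x).snd, (b x).snd)
  map_one' := by ext <;> simp
  map_mul' x y := by ext <;> simp [← h]
  map_zero' := by ext <;> simp
  map_add' x y := by ext <;> simp
  commutes' r := by
    ext <;> simp [TrivSqZeroExt.algebraMap_eq_inl']

/-- `k[V × W]` is the fibre product of `k[V]` and `k[W]` over `k`. -/
lemma sqZero_isPullback :
    IsPullback (sqZeroMap (LinearMap.fst (ResidueField Λ) V W))
      (sqZeroMap (LinearMap.snd (ResidueField Λ) V W)) (sqZeroProj Λ V) (sqZeroProj Λ W) := by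
  have key : ∀ {T : Art Λ} (a : T ⟶ sqZero Λ V) (b : T ⟶ sqZero Λ W),
      a ≫ sqZeroProj Λ V = b ≫ sqZeroProj Λ W →
      ∀ x, TrivSqZeroExt.fst (R := ResidueField Λ) (M := V) (Art.toAlgHom a x) =
        TrivSqZeroExt.fst (R := ResidueField Λ) (M := W) (Art.toAlgHom b x) :=
    fun a b h x => congrArg (fun f => Art.toAlgHom f x) h
  refine ⟨⟨(sqZeroMap_proj _).trans (sqZeroMap_proj _).symm⟩,
    ⟨Limits.PullbackCone.IsLimit.mk _
      (fun s => Art.ofAlgHom (A := s.pt) (B := sqZero Λ (V × W))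
        (prodLift (Art.toAlgHom s.fst) (Art.toAlgHom s.snd) (key _ _ s.condition)))
      (fun s => ?_) (fun s => ?_) ?_⟩⟩
  · refine Art.hom_ext fun x => ?_
    refine TrivSqZeroExt.ext (R := ResidueField Λ) (M := V) ?_ ?_
    · exact (TrivSqZeroExt.fst_map _ _).trans (add_zero _)
    · refine (TrivSqZeroExt.snd_map _ _).trans ?_
      exact congrArg Prod.fst (zero_add _)
  · refine Art.hom_ext fun x => ?_
    refine TrivSqZeroExt.ext (R := ResidueField Λ) (M := W) ?_ ?_
    · exact ((TrivSqZeroExt.fst_map _ _).trans (add_zero _)).trans (key _ _ s.condition x)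
    · refine (TrivSqZeroExt.snd_map _ _).trans ?_
      exact congrArg Prod.snd (zero_add _)
  · intro s m h₁ h₂
    refine Art.hom_ext fun x => ?_
    have e₁ : TrivSqZeroExt.map (LinearMap.fst (ResidueField Λ) V W) (Art.toAlgHom m x) =
      Art.toAlgHom s.fst x := congrArg (fun f => Art.toAlgHom f x) h₁
    have e₂ : TrivSqZeroExt.map (LinearMap.snd (ResidueField Λ) V W) (Art.toAlgHom m x) =
      Art.toAlgHom s.snd x := congrArg (fun f => Art.toAlgHom f x) h₂
    refine TrivSqZeroExt.ext (R := ResidueField Λ) (M := V × W) ?_ ?_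
    · refine ((TrivSqZeroExt.fst_map (LinearMap.fst (ResidueField Λ) V W) _).symm.trans
        (congrArg TrivSqZeroExt.fst e₁)).trans ?_
      exact (add_zero _).symm
    · refine Eq.trans ?_ (zero_add _).symm
      refine Prod.ext ?_ ?_
      · exact (TrivSqZeroExt.snd_map (LinearMap.fst (ResidueField Λ) V W) _).symm.trans
          (congrArg TrivSqZeroExt.snd e₁)
      · exact (TrivSqZeroExt.snd_map (LinearMap.snd (ResidueField Λ) V W) _).symm.trans
          (congrArg TrivSqZeroExt.snd e₂)

end SqZeroMaps

section TangentSpace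

variable {Λ : Type u} [CommRing Λ] [IsLocalRing Λ]

/-- The tangent space `F(k[ε])`. -/
def TangentSpace (F : Art Λ ⥤ Type w) : Type w := F.obj (dual Λ)

namespace TangentSpace

variable {F : Art Λ ⥤ Type w}

section Push

variable {V W : Type u} [AddCommGroup V] [Module (ResidueField Λ) V] [Module (ResidueField Λ)ᵐᵒᵖ V]
  [IsCentralScalar (ResidueField Λ) V] [Module Λ V] [IsScalarTower Λ (ResidueField Λ) V]
  [IsScalarTower Λ (ResidueField Λ)ᵐᵒᵖ V]
  [Module.Finite (ResidueField Λ) V]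
  [AddCommGroup W] [Module (ResidueField Λ) W] [Module (ResidueField Λ)ᵐᵒᵖ W]
  [IsCentralScalar (ResidueField Λ) W] [Module Λ W] [IsScalarTower Λ (ResidueField Λ) W]
  [IsScalarTower Λ (ResidueField Λ)ᵐᵒᵖ W]
  [Module.Finite (ResidueField Λ) W]

/-- The map `F(k[V]) → F(k[ε])` induced by a linear form `L : V → k`. -/
def push (L : V →ₗ[ResidueField Λ] ResidueField Λ) (z : F.obj (sqZero Λ V)) : TangentSpace F :=
  F.map (sqZeroMap L) z

lemma push_push (M : W →ₗ[ResidueField Λ] V) (L : V →ₗ[ResidueField Λ] ResidueField Λ)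
    (z : F.obj (sqZero Λ W)) : push L (F.map (sqZeroMap M) z) = push (L ∘ₗ M) z := by
  unfold push
  rw [← Functor.map_comp_apply, sqZeroMap_comp]

/-- Scalar multiplication by `c`, induced by the endomorphism `ε ↦ c ε` of `k[ε]`. -/
instance : SMul (ResidueField Λ) (TangentSpace F) where
  smul c x := push (c • LinearMap.id) x

lemma push_smul (c : ResidueField Λ) (L : V →ₗ[ResidueField Λ] ResidueField Λ)
    (z : F.obj (sqZero Λ V)) : push (c • L) z = c • push L z := by
  change _ = push _ (F.map _ _)
  rw [push_push]
  rfl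

instance : Neg (TangentSpace F) where
  neg x := (-1 : ResidueField Λ) • x

lemma push_neg (L : V →ₗ[ResidueField Λ] ResidueField Λ) (z : F.obj (sqZero Λ V)) :
    push (-L) z = -push L z := by
  rw [← neg_one_smul (ResidueField Λ) L, push_smul]
  rfl

end Push

section Pair

variable [IsDeformationFunctor F]
variable {V : Type u} [AddCommGroup V] [Module (ResidueField Λ) V] [Module (ResidueField Λ)ᵐᵒᵖ V]
  [IsCentralScalar (ResidueField Λ) V] [Module Λ V] [IsScalarTower Λ (ResidueField Λ) V]
  [IsScalarTower Λ (ResidueField Λ)ᵐᵒᵖ V]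
  [Module.Finite (ResidueField Λ) V]

/-- The identification `F(k[V × k]) = F(k[V]) × F(k[ε])`. -/
lemma existsUnique_pair (z : F.obj (sqZero Λ V)) (y : TangentSpace F) :
    ∃! t : F.obj (sqZero Λ (V × ResidueField Λ)),
      F.map (sqZeroMap (LinearMap.fst _ _ _)) t = z ∧ push (LinearMap.snd _ _ _) t = y := by
  have h := IsDeformationFunctor.h2 (F := F)
    (sqZero_isPullback (Λ := Λ) (V := V) (W := ResidueField Λ))
  obtain ⟨i⟩ := IsDeformationFunctor.singleton (F := F)
  obtain ⟨t, ht, ht'⟩ := h.existsUnique ⟨(z, y), Subsingleton.elim _ _⟩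
  rw [Subtype.ext_iff, Prod.ext_iff] at ht
  exact ⟨t, ht, fun t₂ h₂ => ht' t₂ (Subtype.ext (Prod.ext h₂.1 h₂.2))⟩

/-- The element of `F(k[k × k])` corresponding to a pair of tangent vectors. -/
def pair (x y : TangentSpace F) : F.obj (sqZero Λ (ResidueField Λ × ResidueField Λ)) :=
  (existsUnique_pair x y).choose

/-- Addition of tangent vectors: the composite
`F(k[ε]) × F(k[ε]) = F(k[ε] ×_k k[ε]) → F(k[ε])` induced by addition `k × k → k`. -/
instance : Add (TangentSpace F) where
  add x y := push (LinearMap.fst (ResidueField Λ) (ResidueField Λ) (ResidueField Λ) +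
    LinearMap.snd (ResidueField Λ) (ResidueField Λ) (ResidueField Λ)) (pair x y)

/-- The zero tangent vector: the image of the element of `F(k)` under `k → k[ε]`. -/
instance : Zero (TangentSpace F) where
  zero := F.map (sqZeroIncl (Λ := Λ) (ResidueField Λ))
    (IsDeformationFunctor.singleton (F := F)).some.default

lemma push_zero (z : F.obj (sqZero Λ V)) :
    push (0 : V →ₗ[ResidueField Λ] ResidueField Λ) z = 0 := by
  unfold push
  rw [sqZeroMap_zero, Functor.map_comp_apply]
  exact congrArg _ ((IsDeformationFunctor.singleton (F := F)).some.uniq _)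

lemma push_add (L M : V →ₗ[ResidueField Λ] ResidueField Λ) (z : F.obj (sqZero Λ V)) :
    push (L + M) z = push L z + push M z := by
  have h : F.map (sqZeroMap (L.prod M)) z = pair (push L z) (push M z) := by
    refine (existsUnique_pair (push L z) (push M z)).choose_spec.2 _ ⟨?_, ?_⟩
    · change push _ _ = _
      rw [push_push]
      rfl
    · rw [push_push]
      rfl
  change _ = push _ (pair _ _)
  rw [← h, push_push]
  rfl

/-- Any two tangent vectors are induced by one element, for some `k[V]`. -/
lemma exists_two (x y : TangentSpace F) :
    ∃ (z : F.obj (sqZero Λ (ResidueField Λ × ResidueField Λ)))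
      (L M : (ResidueField Λ × ResidueField Λ) →ₗ[ResidueField Λ] ResidueField Λ),
      push L z = x ∧ push M z = y := by
  obtain ⟨z, hz, -⟩ := existsUnique_pair x y
  exact ⟨z, _, _, hz⟩

lemma exists_three (x y z : TangentSpace F) :
    ∃ (t : F.obj (sqZero Λ ((ResidueField Λ × ResidueField Λ) × ResidueField Λ)))
      (L M N : ((ResidueField Λ × ResidueField Λ) × ResidueField Λ) →ₗ[ResidueField Λ]
        ResidueField Λ), push L t = x ∧ push M t = y ∧ push N t = z := by
  obtain ⟨s, L, M, hL, hM⟩ := exists_two x y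
  obtain ⟨t, ⟨ht, hN⟩, -⟩ := existsUnique_pair s z
  refine ⟨t, L ∘ₗ LinearMap.fst _ _ _, M ∘ₗ LinearMap.fst _ _ _, _, ?_, ?_, hN⟩
  · rw [← push_push, ht, hL]
  · rw [← push_push, ht, hM]

instance : AddCommGroup (TangentSpace F) where
  add_assoc x y z := by
    obtain ⟨t, L, M, N, rfl, rfl, rfl⟩ := exists_three x y z
    simp only [← push_add, add_assoc]
  zero_add x := by
    obtain ⟨t, L, M, rfl, -⟩ := exists_two x x
    rw [← push_zero t, ← push_add, zero_add]
  add_zero x := by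
    obtain ⟨t, L, M, rfl, -⟩ := exists_two x x
    rw [← push_zero t, ← push_add, add_zero]
  neg_add_cancel x := by
    obtain ⟨t, L, M, rfl, -⟩ := exists_two x x
    rw [← push_neg, ← push_add, neg_add_cancel, push_zero]
  add_comm x y := by
    obtain ⟨t, L, M, rfl, rfl⟩ := exists_two x y
    rw [← push_add, ← push_add, add_comm]
  nsmul := nsmulRec
  zsmul := zsmulRec

/-- The `k`-vector space structure on the tangent space of a deformation functor. -/
instance : Module (ResidueField Λ) (TangentSpace F) where
  one_smul x := by
    obtain ⟨t, L, M, rfl, -⟩ := exists_two x x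
    rw [← push_smul, one_smul]
  mul_smul a b x := by
    obtain ⟨t, L, M, rfl, -⟩ := exists_two x x
    simp only [← push_smul, mul_smul]
  smul_zero a := by
    obtain ⟨t, L, M, -, -⟩ := exists_two (0 : TangentSpace F) 0
    rw [← push_zero t, ← push_smul, smul_zero]
  smul_add a x y := by
    obtain ⟨t, L, M, rfl, rfl⟩ := exists_two x y
    simp only [← push_smul, ← push_add, smul_add]
  add_smul a b x := by
    obtain ⟨t, L, M, rfl, -⟩ := exists_two x x
    simp only [← push_smul, ← push_add, add_smul]
  zero_smul x := by
    obtain ⟨t, L, M, rfl, -⟩ := exists_two x x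
    rw [← push_smul, zero_smul, push_zero]

end Pair

end TangentSpace

end TangentSpace

end

end Deformation

/-!
Let `T` be the tangent space, `n` its dimension, and `P = Λ[x₁, …, xₙ]`, with `𝔐 = (𝔪, x₁, …, xₙ)`.
As in Schlessinger's construction of a hull, there is a decreasing sequence of ideals `J_r` of
`P`, each containing a power of `𝔐`, with compatible elements `ξ_r` of `F(P ⧸ J_r)`: the first
quotient is `k[kⁿ]` with an element that induces all tangent vectors, and `J_{r+1}` is minimal
among the ideals between `𝔐 J_r` and `J_r` to whose quotient `ξ_r` lifts
(`Stage.exists_isMinimalLift`). Minimality and (H1) allow a morphism `P ⧸ J_r → A` to be lifted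
along a small extension `B → A` (`Stage.IsMinimalLift.exists_hom`), and the lift can be corrected
by a tangent vector so as to induce a given element of `F(B)` (`exists_hom_of_map_eq`). Hence the
sequence is versal along all surjections (`IsVersalAlong.of_isSurjection`).

It remains to see that every power of `𝔐` contains some `J_r`, for then every morphism
`P ⧸ J_r → A` lifts to `B` because `P` is a polynomial ring
(`exists_map_eq_of_isSurjection`). Suppose that all points `a` of `𝔪ⁿ` define homomorphisms
`P ⧸ J_r → Λ ⧸ 𝔪 ^ l`. By the hypothesis on `F` and versality, each of them lifts to a
homomorphism `P ⧸ J_{r'} → Λ ⧸ 𝔪 ^ (l + 1)`, given by some `b ≡ a` modulo `𝔪 ^ l`. Elements of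
`J_{r'}` have no linear part modulo `𝔪`, so their values at `a` and `b` agree modulo `𝔪 ^ (l + 1)`,
and `a` itself defines a homomorphism to `Λ ⧸ 𝔪 ^ (l + 1)`. By induction, the elements of `J_r` take
values on `𝔪ⁿ` which are arbitrarily small for large `r` (`exists_eval_mem_pow`). A polynomial with
this property has small coefficients in low degrees: in one variable, the coefficients are read off
successively from the values at powers of an element of positive valuation, and division by this
element costs a bounded amount because `ν` is a valuation
(`IsNontrivialValuation.exists_coeff_mem`).

Only the finite levels `Λ ⧸ 𝔪 ^ l` occur, so that power series rings are not needed.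
-/

namespace Deformation

noncomputable section

/-! ### Bijections and fibre products in `Art Λ` -/

section Category

variable {Λ : Type u} [CommRing Λ]

lemma Art.isPullback_of_existsUnique {P A' A'' A : Art Λ} {p₁ : P ⟶ A'} {p₂ : P ⟶ A''}
    {f : A' ⟶ A} {g : A'' ⟶ A} (w : p₁ ≫ f = p₂ ≫ g)
    (h : ∀ a b, toAlgHom f a = toAlgHom g b → ∃! x, toAlgHom p₁ x = a ∧ toAlgHom p₂ x = b) :
    IsPullback p₁ p₂ f g := by
  have hinj : ∀ x y, toAlgHom p₁ x = toAlgHom p₁ y → toAlgHom p₂ x = toAlgHom p₂ y → x = y :=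
    fun x y h₁ h₂ => (h (toAlgHom p₁ y) (toAlgHom p₂ y)
      (congrArg (fun m => toAlgHom m y) w)).unique ⟨h₁, h₂⟩ ⟨rfl, rfl⟩
  have key : ∀ s : Limits.PullbackCone f g, ∃ l : s.pt ⟶ P, l ≫ p₁ = s.fst ∧ l ≫ p₂ = s.snd := by
    intro s
    choose l hl using fun x => (h (toAlgHom s.fst x) (toAlgHom s.snd x)
      (congrArg (fun m => toAlgHom m x) s.condition)).exists
    refine ⟨ofAlgHom
      { toFun := l
        map_one' := hinj _ _ ?_ ?_
        map_mul' := fun x y => hinj _ _ ?_ ?_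
        map_zero' := hinj _ _ ?_ ?_
        map_add' := fun x y => hinj _ _ ?_ ?_
        commutes' := fun r => hinj _ _ ?_ ?_ }, hom_ext fun x => ?_, hom_ext fun x => ?_⟩
    all_goals simp [(hl _).1, (hl _).2]
  choose l hl₁ hl₂ using key
  refine ⟨⟨w⟩, ⟨Limits.PullbackCone.IsLimit.mk _ l hl₁ hl₂ fun s m h₁ h₂ => hom_ext fun x => ?_⟩⟩
  refine hinj _ _ ?_ ?_
  · rw [← toAlgHom_comp, ← toAlgHom_comp, h₁, hl₁]
  · rw [← toAlgHom_comp, ← toAlgHom_comp, h₂, hl₂]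

lemma Art.exists_inverse_of_bijective {A B : Art Λ} (f : A ⟶ B)
    (hf : Function.Bijective (toAlgHom f)) : ∃ g : B ⟶ A, f ≫ g = 𝟙 A ∧ g ≫ f = 𝟙 B := by
  let e := AlgEquiv.ofBijective (toAlgHom f) hf
  exact ⟨ofAlgHom e.symm.toAlgHom, hom_ext fun x => e.symm_apply_apply x,
    hom_ext fun x => e.apply_symm_apply x⟩

lemma isNilpotent_of_mem_maximalIdeal {A : Type*} [CommRing A] [IsLocalRing A] [IsArtinianRing A]
    {x : A} (hx : x ∈ maximalIdeal A) : IsNilpotent x := by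
  obtain ⟨n, hn⟩ := (isArtinianRing_iff_isNilpotent_maximalIdeal A).1 ‹_›
  refine ⟨n, ?_⟩
  have := Ideal.pow_mem_pow hx n
  rwa [hn] at this

instance Art.isLocalHom {A B : Art Λ} (f : A.obj →ₐ[Λ] B.obj) : IsLocalHom f := by
  refine ⟨fun a ha => ?_⟩
  by_contra h
  exact ((isNilpotent_of_mem_maximalIdeal ((mem_maximalIdeal a).2 h)).map f).not_isUnit ha

lemma Art.map_mem_maximalIdeal {A B : Art Λ} (f : A.obj →ₐ[Λ] B.obj) {x : A.obj} :
    f x ∈ maximalIdeal B.obj ↔ x ∈ maximalIdeal A.obj := by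
  simp [mem_maximalIdeal, mem_nonunits_iff]

lemma Art.exists_sub_mem (A : Art Λ) (x : A.obj) :
    ∃ r : Λ, x - algebraMap Λ A.obj r ∈ maximalIdeal A.obj := by
  obtain ⟨r, hr⟩ := A.property.choose_spec.2 (residue _ x)
  refine ⟨r, ?_⟩
  rw [← residue_eq_zero_iff, map_sub, sub_eq_zero]
  exact hr.symm

lemma isArtAlg_of_exists_sub_mem {A : Type u} [CommRing A] [Algebra Λ A] [IsLocalRing A]
    [IsArtinianRing A] (h : ∀ x : A, ∃ r : Λ, x - algebraMap Λ A r ∈ maximalIdeal A) :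
    Function.Surjective (fun x : Λ => residue A (algebraMap Λ A x)) := by
  intro y
  obtain ⟨x, rfl⟩ := residue_surjective y
  obtain ⟨r, hr⟩ := h x
  refine ⟨r, ?_⟩
  rw [← residue_eq_zero_iff, map_sub, sub_eq_zero] at hr
  exact hr.symm

/-- A module of finite length over an algebra in `Art Λ` is Artinian over `Λ`: the two rings have
the same residue field, hence the same simple modules. -/
lemma Art.isArtinian_of_isFiniteLength (A : Art Λ) {M : Type u} [AddCommGroup M] [Module A.obj M]
    (h : IsFiniteLength A.obj M) :
    @IsArtinian Λ M _ _ (Module.compHom M (algebraMap Λ A.obj)) := by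
  induction h with
  | @of_subsingleton M _ _ _ =>
    exact @isArtinian_of_finite Λ M _ _ (Module.compHom M (algebraMap Λ A.obj)) _
  | @of_simple_quotient M _ _ N _ _ ih =>
    let : Module Λ M := Module.compHom M (algebraMap Λ A.obj)
    have : IsScalarTower Λ A.obj M := ⟨fun r a x => by
      rw [Algebra.smul_def, mul_smul]; rfl⟩
    have h₁ : IsArtinian Λ N := ih
    have h₂ : IsArtinian Λ (M ⧸ N) := by
      have : IsSimpleOrder (Submodule Λ (M ⧸ N)) := by
        have := IsSimpleModule.nontrivial A.obj (M ⧸ N)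
        refine { eq_bot_or_eq_top := fun K => or_iff_not_imp_left.2 fun hK => ?_ }
        obtain ⟨x, hx, hx0⟩ := K.ne_bot_iff.1 hK
        refine eq_top_iff.2 fun y _ => ?_
        obtain ⟨a, rfl⟩ := IsSimpleModule.toSpanSingleton_surjective A.obj hx0 y
        obtain ⟨r, hr⟩ := A.exists_sub_mem a
        have hm := IsLocalRing.eq_maximalIdeal
          (IsSimpleModule.annihilator_isMaximal (R := A.obj) (M := M ⧸ N))
        rw [← hm, Module.mem_annihilator] at hr
        have := hr x
        rw [sub_smul, sub_eq_zero, algebraMap_smul] at this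
        rw [LinearMap.toSpanSingleton_apply, this]
        exact K.smul_mem _ hx
      have : IsSimpleModule Λ (M ⧸ N) := ⟨⟩
      infer_instance
    exact (isArtinian_iff_submodule_quotient (N.restrictScalars Λ)).2 ⟨h₁, h₂⟩

instance Art.isArtinian (A : Art Λ) : IsArtinian Λ A.obj := by
  have := A.isArtinian_of_isFiniteLength (M := A.obj)
    (isFiniteLength_iff_isNoetherian_isArtinian.2 ⟨inferInstance, inferInstance⟩)
  have h : Module.compHom A.obj (algebraMap Λ A.obj) = Algebra.toModule :=
    Module.ext' _ _ fun r x => (Algebra.smul_def r x).symm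
  rwa [h] at this

section FiberProduct

variable {A' A'' A : Art Λ} (f : A' ⟶ A) (g : A'' ⟶ A)

/-- The fibre product `A' ×_A A''` of rings, as a subalgebra of `A' × A''`. -/
abbrev fiberSubalgebra : Subalgebra Λ (A'.obj × A''.obj) :=
  AlgHom.equalizer ((Art.toAlgHom f).comp (AlgHom.fst Λ A'.obj A''.obj))
    ((Art.toAlgHom g).comp (AlgHom.snd Λ A'.obj A''.obj))

lemma isUnit_fiberSubalgebra_iff (x : fiberSubalgebra f g) : IsUnit x ↔ IsUnit x.1.1 := by
  refine ⟨fun h => h.map ((AlgHom.fst Λ A'.obj A''.obj).comp (fiberSubalgebra f g).val),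
    fun h => ?_⟩
  have hx : Art.toAlgHom f x.1.1 = Art.toAlgHom g x.1.2 := x.2
  have h' : IsUnit x.1.2 := by
    rw [← isUnit_map_iff (Art.toAlgHom g), ← hx]
    exact h.map _
  obtain ⟨u, hu⟩ := h.exists_right_inv
  obtain ⟨v, hv⟩ := h'.exists_right_inv
  refine IsUnit.of_mul_eq_one ⟨(u, v), ?_⟩ (Subtype.ext (Prod.ext hu hv))
  change Art.toAlgHom f u = Art.toAlgHom g v
  refine (h.map (Art.toAlgHom f)).mul_left_cancel ?_
  rw [← map_mul, hu, hx, ← map_mul, hv, map_one, map_one]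

instance : IsLocalRing (fiberSubalgebra f g) := by
  refine IsLocalRing.of_isUnit_or_isUnit_one_sub_self fun x => ?_
  rw [isUnit_fiberSubalgebra_iff, isUnit_fiberSubalgebra_iff]
  exact IsLocalRing.isUnit_or_isUnit_one_sub_self x.1.1

instance : IsArtinianRing (fiberSubalgebra f g) := by
  have : IsArtinian Λ (fiberSubalgebra f g) :=
    isArtinian_of_injective (fiberSubalgebra f g).val.toLinearMap Subtype.val_injective
  exact isArtinian_of_tower Λ this

/-- The fibre product `A' ×_A A''` in `Art Λ`. -/
def fiberProduct : Art Λ :=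
  Art.of (fiberSubalgebra f g) (isArtAlg_of_exists_sub_mem fun x => by
    obtain ⟨r, hr⟩ := A'.exists_sub_mem x.1.1
    refine ⟨r, ?_⟩
    rw [mem_maximalIdeal, mem_nonunits_iff] at hr ⊢
    rwa [isUnit_fiberSubalgebra_iff])

/-- The first projection of the fibre product. -/
def fiberFst : fiberProduct f g ⟶ A' :=
  Art.ofAlgHom (A := fiberProduct f g)
    ((AlgHom.fst Λ A'.obj A''.obj).comp (fiberSubalgebra f g).val)

/-- The second projection of the fibre product. -/
def fiberSnd : fiberProduct f g ⟶ A'' :=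
  Art.ofAlgHom (A := fiberProduct f g)
    ((AlgHom.snd Λ A'.obj A''.obj).comp (fiberSubalgebra f g).val)

variable {f g} in
lemma fiberProduct_existsUnique (a : A'.obj) (b : A''.obj)
    (h : Art.toAlgHom f a = Art.toAlgHom g b) :
    ∃! x, Art.toAlgHom (fiberFst f g) x = a ∧ Art.toAlgHom (fiberSnd f g) x = b :=
  ⟨⟨(a, b), h⟩, ⟨rfl, rfl⟩, fun _ hy => Subtype.ext (Prod.ext hy.1 hy.2)⟩

lemma fiberProduct_condition : fiberFst f g ≫ f = fiberSnd f g ≫ g :=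
  Art.hom_ext fun x => Subtype.property (p := (· ∈ fiberSubalgebra f g)) x

lemma fiberProduct_isPullback : IsPullback (fiberFst f g) (fiberSnd f g) f g :=
  Art.isPullback_of_existsUnique (fiberProduct_condition f g) fiberProduct_existsUnique

end FiberProduct

end Category

/-! ### Residue fields and the action of tangent vectors -/

section Residue

variable {Λ : Type u} [CommRing Λ] [IsLocalRing Λ]

lemma Art.algebraMap_mem_maximalIdeal (A : Art Λ) {r : Λ} :
    algebraMap Λ A.obj r ∈ maximalIdeal A.obj ↔ r ∈ maximalIdeal Λ := by
  have h : RingHom.ker ((residue A.obj).comp (algebraMap Λ A.obj)) = maximalIdeal Λ :=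
    IsLocalRing.eq_maximalIdeal
      (RingHom.ker_isMaximal_of_surjective _ A.property.choose_spec.2)
  rw [← h, RingHom.mem_ker, RingHom.comp_apply, residue_eq_zero_iff]

lemma Art.toResField_apply {A : Art Λ} (f : A ⟶ resField Λ) {x : A.obj} {r : Λ}
    (hr : x - algebraMap Λ A.obj r ∈ maximalIdeal A.obj) : toAlgHom f x = residue Λ r := by
  have h : toAlgHom f (x - algebraMap Λ A.obj r) = 0 :=
    IsReduced.eq_zero (R := ResidueField Λ) _
      ((isNilpotent_of_mem_maximalIdeal hr).map (toAlgHom f))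
  rw [map_sub, sub_eq_zero, AlgHom.commutes] at h
  exact h

lemma Art.toResField_ext {A : Art Λ} (f g : A ⟶ resField Λ) : f = g := by
  refine hom_ext fun x => ?_
  obtain ⟨r, hr⟩ := A.exists_sub_mem x
  exact (toResField_apply f hr).trans (toResField_apply g hr).symm

lemma Art.exists_toResField (A : Art Λ) : Nonempty (A ⟶ resField Λ) := by
  have hinj : ∀ {x : A.obj} {r s : Λ}, x - algebraMap Λ A.obj r ∈ maximalIdeal A.obj →
      x - algebraMap Λ A.obj s ∈ maximalIdeal A.obj → residue Λ r = residue Λ s := by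
    intro x r s h₁ h₂
    rw [← sub_eq_zero, ← map_sub, residue_eq_zero_iff, ← A.algebraMap_mem_maximalIdeal]
    convert sub_mem h₂ h₁ using 1
    rw [map_sub]
    ring
  choose ρ hρ using A.exists_sub_mem
  refine ⟨Art.ofAlgHom (B := resField Λ)
    ({ toFun := fun x => residue Λ (ρ x)
       map_one' := ?_
       map_mul' := fun x y => ?_
       map_zero' := ?_
       map_add' := fun x y => ?_
       commutes' := fun r => ?_ } : A.obj →ₐ[Λ] ResidueField Λ)⟩
  · rw [← map_one (residue Λ)]
    exact hinj (hρ 1) (by simp)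
  · rw [← map_mul]
    refine hinj (hρ _) ?_
    convert add_mem (Ideal.mul_mem_left _ x (hρ y))
      (Ideal.mul_mem_left _ (algebraMap Λ A.obj (ρ y)) (hρ x)) using 1
    rw [map_mul]
    ring
  · rw [← map_zero (residue Λ)]
    exact hinj (hρ 0) (by simp)
  · rw [← map_add]
    refine hinj (hρ _) ?_
    convert add_mem (hρ x) (hρ y) using 1
    rw [map_add]
    ring
  · exact hinj (hρ _) (by simp)

/-- The projection of an object of `Art Λ` onto its residue field. -/
def Art.toResField (A : Art Λ) : A ⟶ resField Λ := A.exists_toResField.some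

end Residue

section Tangent

variable {Λ : Type u} [CommRing Λ] [IsLocalRing Λ] {F : Art Λ ⥤ Type w} [IsDeformationFunctor F]

/-- An element `ξ` of `F(R)` is versal on tangent vectors if every tangent vector of `F` is induced
from `ξ` by a morphism `R → k[ε]`. -/
def IsTangentVersal {R : Art Λ} (ξ : F.obj R) : Prop :=
  ∀ v : F.obj (dual Λ), ∃ l : R ⟶ dual Λ, F.map l ξ = v

/-- Two elements of `F(B)` with the same image under a small extension `B → A` differ by a tangent
vector, because `B ×_A B` is isomorphic to `B ×_k k[ε]`. If one of them is induced from an element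
`ξ` that is versal on tangent vectors, then so is the other. -/
lemma exists_hom_of_map_eq {B A R : Art Λ} {p : B ⟶ A} (hp : IsSmallExtension p) {ξ : F.obj R}
    (hξ : IsTangentVersal ξ) (φ : R ⟶ B) (η : F.obj B)
    (h : F.map p (F.map φ ξ) = F.map p η) :
    ∃ φ' : R ⟶ B, φ' ≫ p = φ ≫ p ∧ F.map φ' ξ = η := by
  obtain ⟨hp₁, t, ht0, hker, ht⟩ := id hp
  have htker : Art.toAlgHom p t = 0 := by
    have : t ∈ RingHom.ker (Art.toAlgHom p) := hker ▸ Ideal.mem_span_singleton_self t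
    exact this
  have htt : t * t = 0 := ht t (by
    rw [← Art.map_mem_maximalIdeal (Art.toAlgHom p), htker]
    exact zero_mem _)
  -- The additive map `k → B`, `v ↦ v t`.
  obtain ⟨c, hc⟩ : ∃ c : ResidueField Λ →ₗ[Λ] B.obj,
      ∀ r, c (residue Λ r) = algebraMap Λ B.obj r * t :=
    ⟨Submodule.liftQ (maximalIdeal Λ) ((LinearMap.toSpanSingleton Λ B.obj t)) (fun r hr => by
      rw [LinearMap.mem_ker, LinearMap.toSpanSingleton_apply, Algebra.smul_def]
      exact ht _ (B.algebraMap_mem_maximalIdeal.2 hr)), fun r => by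
      rw [← Algebra.smul_def]
      exact Submodule.liftQ_apply _ _ r⟩
  have hcmul : ∀ (b : B.obj) (v : ResidueField Λ),
      c ((show ResidueField Λ from Art.toAlgHom B.toResField b) * v) = b * c v := by
    intro b v
    obtain ⟨r, hr⟩ := B.exists_sub_mem b
    obtain ⟨s, rfl⟩ := residue_surjective v
    have h := ht _ hr
    rw [sub_mul, sub_eq_zero] at h
    rw [Art.toResField_apply _ hr, ← map_mul, hc, hc, map_mul, mul_left_comm b, h]
    ring
  have hct : ∀ v, ∃ b : B.obj, c v = b * t := fun v => by
    obtain ⟨s, rfl⟩ := residue_surjective v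
    exact ⟨_, hc s⟩
  have hcc : ∀ v w, c v * c w = 0 := fun v w => by
    obtain ⟨x, hx⟩ := hct v
    obtain ⟨y, hy⟩ := hct w
    rw [hx, hy, mul_mul_mul_comm, htt, mul_zero]
  have hcinj : ∀ v, c v = 0 → v = 0 := fun v hv => by
    obtain ⟨s, rfl⟩ := residue_surjective v
    rw [residue_eq_zero_iff, ← B.algebraMap_mem_maximalIdeal, mem_maximalIdeal, mem_nonunits_iff]
    intro hu
    rw [hc, hu.mul_right_eq_zero] at hv
    exact ht0 hv
  let q := sqZeroProj Λ (ResidueField Λ)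
  let E := fiberProduct B.toResField q
  let e₁ : E.obj →ₐ[Λ] B.obj := Art.toAlgHom (fiberFst B.toResField q)
  let e₂ : E.obj →ₐ[Λ] TrivSqZeroExt (ResidueField Λ) (ResidueField Λ) :=
    Art.toAlgHom (fiberSnd B.toResField q)
  have he : ∀ x, (e₂ x).fst = Art.toAlgHom B.toResField (e₁ x) := fun x =>
    (congrArg (fun f => Art.toAlgHom f x) (fiberProduct_condition B.toResField q)).symm
  let s : E ⟶ B := Art.ofAlgHom
    { toFun := fun x => e₁ x + c (e₂ x).snd
      map_one' := by simp
      map_mul' := fun x y => by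
        simp only [map_mul, TrivSqZeroExt.snd_mul, smul_eq_mul, MulOpposite.smul_eq_mul_unop,
          MulOpposite.unop_op, map_add]
        rw [mul_comm (e₂ x).snd, he, he, hcmul, hcmul]
        linear_combination -hcc (e₂ x).snd (e₂ y).snd
      map_zero' := by simp
      map_add' := fun x y => by
        simp only [map_add, TrivSqZeroExt.snd_add]
        ring
      commutes' := fun r => by
        simp [TrivSqZeroExt.algebraMap_eq_inl'] }
  have hs : ∀ x, Art.toAlgHom s x = e₁ x + c (e₂ x).snd := fun _ => rfl
  have hpb : IsPullback (fiberFst B.toResField q) s p p := by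
    refine Art.isPullback_of_existsUnique (Art.hom_ext fun x => ?_) fun a b hab => ?_
    · change Art.toAlgHom p (e₁ x) = Art.toAlgHom p (e₁ x + c (e₂ x).snd)
      obtain ⟨b, hb⟩ := hct (e₂ x).snd
      rw [hb, map_add, map_mul, htker, mul_zero, add_zero]
    · have hmem : b - a ∈ Ideal.span {t} := by
        rw [← hker, RingHom.mem_ker, map_sub, sub_eq_zero]
        exact hab.symm
      obtain ⟨d, hd⟩ := Ideal.mem_span_singleton'.1 hmem
      obtain ⟨r, hr⟩ := B.exists_sub_mem d
      have hcr : c (residue Λ r) = b - a := by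
        have := ht _ hr
        rw [sub_mul, sub_eq_zero] at this
        rw [hc, ← this, hd]
      let y : TrivSqZeroExt (ResidueField Λ) (ResidueField Λ) :=
        TrivSqZeroExt.inl (show ResidueField Λ from Art.toAlgHom B.toResField a) +
          TrivSqZeroExt.inr (residue Λ r)
      have hy : Art.toAlgHom B.toResField a = Art.toAlgHom q y := (add_zero _).symm
      obtain ⟨x, ⟨hx₁, hx₂⟩, hx⟩ :=
        fiberProduct_existsUnique (f := B.toResField) (g := q) a y hy
      have hysnd : y.snd = residue Λ r := zero_add _
      have hx₂' : e₂ x = y := hx₂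
      refine ⟨x, ⟨hx₁, ?_⟩, fun x' hx' => hx x' ⟨hx'.1, ?_⟩⟩
      · rw [hs, show e₁ x = a from hx₁, hx₂', hysnd, hcr, add_sub_cancel]
      · have h₁ : e₁ x' = a := hx'.1
        have h₂ := hx'.2
        rw [hs, h₁, ← eq_sub_iff_add_eq', ← hcr, ← sub_eq_zero, ← map_sub] at h₂
        refine TrivSqZeroExt.ext (R := ResidueField Λ) (M := ResidueField Λ) ?_ ?_
        · exact ((he x').trans (by rw [h₁])).trans hy
        · exact (sub_eq_zero.1 (hcinj _ h₂)).trans hysnd.symm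
  obtain ⟨ζ, hζ⟩ := IsDeformationFunctor.h1 (F := F) hpb hp ⟨(F.map φ ξ, η), h⟩
  rw [Subtype.ext_iff, Prod.ext_iff] at hζ
  obtain ⟨hζ₁ : F.map _ ζ = F.map φ ξ, hζ₂ : F.map s ζ = η⟩ := hζ
  obtain ⟨l, hl⟩ := hξ (F.map (fiberSnd B.toResField q) ζ)
  have hpb' := fiberProduct_isPullback B.toResField q
  let m := hpb'.lift φ l (Art.toResField_ext _ _)
  have hm : F.map m ξ = ζ := by
    refine (IsDeformationFunctor.h2 (F := F) hpb').1 (Subtype.ext (Prod.ext ?_ ?_))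
    · change F.map _ (F.map m ξ) = F.map _ ζ
      rw [← Functor.map_comp_apply, hpb'.lift_fst, hζ₁]
    · change F.map _ (F.map m ξ) = F.map _ ζ
      rw [← Functor.map_comp_apply, hpb'.lift_snd, hl]
  refine ⟨m ≫ s, ?_, ?_⟩
  · rw [Category.assoc, ← hpb.w, ← Category.assoc, hpb'.lift_fst]
  · rw [Functor.map_comp_apply, hm, hζ₂]

end Tangent

/-! ### Artinian quotients -/

section Quotient

variable {Λ : Type u} [CommRing Λ] {R : Type u} [CommRing R] [Algebra Λ R]

variable (Λ R) in
/-- An ideal `J` of a `Λ`-algebra `R` such that `R ⧸ J` is an object of `Art Λ`. -/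
def ArtIdeal : Type u := {J : Ideal R // IsArtAlg Λ (CommAlgCat.of Λ (R ⧸ J))}

namespace ArtIdeal

instance : CoeOut (ArtIdeal Λ R) (Ideal R) := ⟨Subtype.val⟩

/-- The object `R ⧸ J` of `Art Λ`. -/
def quot (J : ArtIdeal Λ R) : Art Λ := ⟨_, J.2⟩

/-- The quotient map `R → R ⧸ J`. -/
def mk (J : ArtIdeal Λ R) : R →ₐ[Λ] J.quot.obj := Ideal.Quotient.mkₐ Λ (J : Ideal R)

lemma mk_surjective (J : ArtIdeal Λ R) : Function.Surjective J.mk :=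
  Ideal.Quotient.mk_surjective

lemma mk_eq_zero_iff (J : ArtIdeal Λ R) {x : R} : J.mk x = 0 ↔ x ∈ (J : Ideal R) :=
  Ideal.Quotient.eq_zero_iff_mem

/-- The morphism `R ⧸ J → A` induced by a homomorphism `R → A` that kills `J`. -/
def lift (J : ArtIdeal Λ R) {A : Art Λ} (f : R →ₐ[Λ] A.obj) (h : (J : Ideal R) ≤ RingHom.ker f) :
    J.quot ⟶ A :=
  Art.ofAlgHom (A := J.quot) (Ideal.Quotient.liftₐ (J : Ideal R) f h)

@[simp] lemma lift_mk (J : ArtIdeal Λ R) {A : Art Λ} (f : R →ₐ[Λ] A.obj)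
    (h : (J : Ideal R) ≤ RingHom.ker f) (x : R) : Art.toAlgHom (J.lift f h) (J.mk x) = f x := rfl

lemma hom_ext {J : ArtIdeal Λ R} {A : Art Λ} {f g : J.quot ⟶ A}
    (h : ∀ x, Art.toAlgHom f (J.mk x) = Art.toAlgHom g (J.mk x)) : f = g :=
  Art.hom_ext fun y => by
    obtain ⟨x, rfl⟩ := J.mk_surjective y
    exact h x

/-- The projection `R ⧸ J → R ⧸ K` for `J ≤ K`. -/
def factor {J K : ArtIdeal Λ R} (h : (J : Ideal R) ≤ K) : J.quot ⟶ K.quot :=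
  J.lift K.mk fun _ hx => K.mk_eq_zero_iff.2 (h hx)

@[simp] lemma factor_mk {J K : ArtIdeal Λ R} (h : (J : Ideal R) ≤ K) (x : R) :
    Art.toAlgHom (factor h) (J.mk x) = K.mk x := rfl

lemma factor_comp_factor {I J K : ArtIdeal Λ R} (h : (I : Ideal R) ≤ J) (h' : (J : Ideal R) ≤ K) :
    factor h ≫ factor h' = factor (h.trans h') := hom_ext fun _ => rfl

lemma factor_self {J : ArtIdeal Λ R} (h : (J : Ideal R) ≤ J) : factor h = 𝟙 _ :=
  hom_ext fun _ => rfl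

lemma factor_surjective {J K : ArtIdeal Λ R} (h : (J : Ideal R) ≤ K) : IsSurjection (factor h) :=
  fun y => by
    obtain ⟨x, rfl⟩ := K.mk_surjective y
    exact ⟨J.mk x, rfl⟩

/-- A projection `R ⧸ K → R ⧸ J` is a small extension if `J` is generated over `K` by one
element which is annihilated by the maximal ideal of `R ⧸ K`. -/
lemma factor_isSmallExtension {J K : ArtIdeal Λ R} (h : (K : Ideal R) ≤ J) {x : R}
    (hxJ : x ∈ (J : Ideal R)) (hxK : x ∉ (K : Ideal R))
    (hJ : (J : Ideal R) ≤ (K : Ideal R) ⊔ Ideal.span {x})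
    (hx : ∀ y, K.mk y ∈ maximalIdeal K.quot.obj → y * x ∈ (K : Ideal R)) :
    IsSmallExtension (factor h) := by
  refine ⟨factor_surjective h, K.mk x, fun h0 => hxK (K.mk_eq_zero_iff.1 h0), ?_, ?_⟩
  · refine le_antisymm (fun y hy => ?_) ?_
    · obtain ⟨y, rfl⟩ := K.mk_surjective y
      obtain ⟨a, ha, b, hb, rfl⟩ := Submodule.mem_sup.1 (hJ (J.mk_eq_zero_iff.1 hy))
      obtain ⟨d, rfl⟩ := Ideal.mem_span_singleton'.1 hb
      rw [map_add, K.mk_eq_zero_iff.2 ha, zero_add, map_mul]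
      exact Ideal.mul_mem_left _ _ (Ideal.mem_span_singleton_self _)
    · rw [Ideal.span_singleton_le_iff_mem]
      exact J.mk_eq_zero_iff.2 hxJ
  · intro y hy
    obtain ⟨y, rfl⟩ := K.mk_surjective y
    rw [← map_mul, K.mk_eq_zero_iff]
    exact hx y hy

/-- If `J = J₁ + J₂`, then `R ⧸ (J₁ ∩ J₂)` is the fibre product of `R ⧸ J₁` and `R ⧸ J₂` over
`R ⧸ J`. -/
lemma isPullback_inf {I J₁ J₂ J : ArtIdeal Λ R} (h₁ : (J₁ : Ideal R) ≤ J) (h₂ : (J₂ : Ideal R) ≤ J)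
    (hJ : (J : Ideal R) ≤ (J₁ : Ideal R) ⊔ J₂) (hI : (I : Ideal R) = ↑J₁ ⊓ ↑J₂) :
    IsPullback (factor (hI.le.trans inf_le_left)) (factor (hI.le.trans inf_le_right))
      (factor h₁) (factor h₂) := by
  refine Art.isPullback_of_existsUnique (hom_ext fun x => rfl) fun a b hab => ?_
  obtain ⟨a, rfl⟩ := J₁.mk_surjective a
  obtain ⟨b, rfl⟩ := J₂.mk_surjective b
  rw [factor_mk, factor_mk, ← sub_eq_zero, ← map_sub, mk_eq_zero_iff] at hab
  obtain ⟨y, hy, z, hz, hyz⟩ := Submodule.mem_sup.1 (hJ hab)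
  refine ⟨I.mk (a - y), ⟨?_, ?_⟩, fun c hc => ?_⟩
  · rw [factor_mk, map_sub, J₁.mk_eq_zero_iff.2 hy, sub_zero]
  · rw [factor_mk, show a - y = b + z by linear_combination -hyz, map_add,
      J₂.mk_eq_zero_iff.2 hz, add_zero]
  · obtain ⟨c, rfl⟩ := I.mk_surjective c
    rw [factor_mk, factor_mk, ← sub_eq_zero, ← map_sub, mk_eq_zero_iff,
      ← sub_eq_zero (b := J₂.mk b), ← map_sub, mk_eq_zero_iff] at hc
    rw [← sub_eq_zero, ← map_sub, mk_eq_zero_iff, hI]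
    refine ⟨show _ ∈ (J₁ : Ideal R) from ?_, show _ ∈ (J₂ : Ideal R) from ?_⟩
    · convert add_mem hc.1 hy using 1
      ring
    · convert sub_mem hc.2 hz using 1
      linear_combination hyz

end ArtIdeal

/-- If `𝔐` is a maximal ideal of a Noetherian `Λ`-algebra `R` whose residue field is a quotient of
`Λ`, then `R ⧸ J` is an object of `Art Λ` for all ideals `J ≤ 𝔐` that contain a power of `𝔐`. -/
lemma isArtAlg_quotient [IsNoetherianRing R] {M : Ideal R} (hM : M.IsMaximal)
    (hs : ∀ x : R, ∃ r : Λ, x - algebraMap Λ R r ∈ M) {J : Ideal R} (hJ : J ≤ M) {q : ℕ}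
    (hq : M ^ q ≤ J) : IsArtAlg Λ (CommAlgCat.of Λ (R ⧸ J)) := by
  have hnt : Nontrivial (R ⧸ J) :=
    Ideal.Quotient.nontrivial_iff.2 (ne_top_of_le_ne_top hM.ne_top hJ)
  have huniq : ∀ N : Ideal (R ⧸ J), N.IsMaximal → N = M.map (Ideal.Quotient.mk J) := by
    intro N hN
    have := Ideal.comap_isMaximal_of_surjective (Ideal.Quotient.mk J)
      Ideal.Quotient.mk_surjective (K := N)
    have hJN : J ≤ N.comap (Ideal.Quotient.mk J) := fun x hx => by
      rw [Ideal.mem_comap, Ideal.Quotient.eq_zero_iff_mem.2 hx]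
      exact zero_mem _
    rw [hM.eq_of_le this.ne_top (this.isPrime.le_of_pow_le (hq.trans hJN)),
      Ideal.map_comap_of_surjective _ Ideal.Quotient.mk_surjective]
  obtain ⟨N, hN⟩ := Ideal.exists_maximal (R ⧸ J)
  have hloc : IsLocalRing (R ⧸ J) :=
    IsLocalRing.of_unique_max_ideal ⟨N, hN, fun N' hN' => (huniq N' hN').trans (huniq N hN).symm⟩
  have hmax := huniq _ (maximalIdeal.isMaximal (R ⧸ J))
  have hart : IsArtinianRing (R ⧸ J) := by
    rw [isArtinianRing_iff_isNilpotent_maximalIdeal]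
    refine ⟨q, ?_⟩
    rw [hmax, ← Ideal.map_pow, Ideal.zero_eq_bot, Ideal.map_eq_bot_iff_le_ker, Ideal.mk_ker]
    exact hq
  refine ⟨hloc, hart, isArtAlg_of_exists_sub_mem fun x => ?_⟩
  obtain ⟨x, rfl⟩ := Ideal.Quotient.mk_surjective x
  obtain ⟨r, hr⟩ := hs x
  refine ⟨r, ?_⟩
  rw [hmax]
  exact Ideal.mem_map_of_mem (Ideal.Quotient.mk J) hr

end Quotient

/-! ### Elements over quotients of a polynomial ring, and their minimal extensions -/

section Origin

/-- Polynomial rings are projective: a homomorphism to an algebra in `Art Λ` lifts along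
surjections. -/
lemma exists_algHom_lift {Λ : Type u} [CommRing Λ] {n : ℕ} {B A : Art Λ} {p : B ⟶ A}
    (hp : IsSurjection p) (f : MvPolynomial (Fin n) Λ →ₐ[Λ] A.obj) :
    ∃ g : MvPolynomial (Fin n) Λ →ₐ[Λ] B.obj, ∀ x, Art.toAlgHom p (g x) = f x := by
  choose b hb using fun i => hp (f (MvPolynomial.X i))
  refine ⟨MvPolynomial.aeval b, fun x => ?_⟩
  have : (Art.toAlgHom p).comp (MvPolynomial.aeval b) = f :=
    MvPolynomial.algHom_ext fun i => by simp [hb]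
  exact DFunLike.congr_fun this x

variable {Λ : Type u} [CommRing Λ] [IsLocalRing Λ] {n : ℕ}

variable (Λ n) in
/-- The maximal ideal `(𝔪, x₁, …, xₙ)` of `Λ[x₁, …, xₙ]`. -/
def origin : Ideal (MvPolynomial (Fin n) Λ) :=
  (maximalIdeal Λ).comap MvPolynomial.constantCoeff

lemma mem_origin {f : MvPolynomial (Fin n) Λ} :
    f ∈ origin Λ n ↔ MvPolynomial.constantCoeff f ∈ maximalIdeal Λ := Iff.rfl

lemma origin_isMaximal : (origin Λ n).IsMaximal :=
  Ideal.comap_isMaximal_of_surjective _ fun r =>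
    ⟨MvPolynomial.C r, MvPolynomial.constantCoeff_C _ r⟩

lemma exists_sub_mem_origin (f : MvPolynomial (Fin n) Λ) :
    ∃ r : Λ, f - algebraMap Λ _ r ∈ origin Λ n := by
  refine ⟨MvPolynomial.constantCoeff f, ?_⟩
  rw [mem_origin, map_sub, MvPolynomial.algebraMap_eq, MvPolynomial.constantCoeff_C, sub_self]
  exact zero_mem _

variable {A : Art Λ} {f : MvPolynomial (Fin n) Λ →ₐ[Λ] A.obj}

lemma exists_origin_pow_le_ker (h : ∀ x ∈ origin Λ n, f x ∈ maximalIdeal A.obj) :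
    ∃ q, origin Λ n ^ q ≤ RingHom.ker f := by
  obtain ⟨q, hq⟩ := (isArtinianRing_iff_isNilpotent_maximalIdeal A.obj).1 inferInstance
  refine ⟨q, fun x hx => ?_⟩
  have := Ideal.mem_map_of_mem f hx
  rw [Ideal.map_pow] at this
  have hle : (origin Λ n).map f ≤ maximalIdeal A.obj :=
    Ideal.map_le_iff_le_comap.2 fun y hy => h y hy
  have h' := Ideal.pow_right_mono hle q this
  rwa [hq] at h'

lemma map_mem_maximalIdeal_iff {q : ℕ} (hq : origin Λ n ^ q ≤ RingHom.ker f)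
    {x : MvPolynomial (Fin n) Λ} : f x ∈ maximalIdeal A.obj ↔ x ∈ origin Λ n := by
  have hp : ((maximalIdeal A.obj).comap f).IsPrime := Ideal.comap_isPrime f _
  have hle : origin Λ n ^ q ≤ (maximalIdeal A.obj).comap f := fun y hy => by
    have h0 : f y = 0 := hq hy
    rw [Ideal.mem_comap, h0]
    exact zero_mem _
  rw [origin_isMaximal.eq_of_le hp.ne_top (hp.le_of_pow_le hle)]
  rfl

lemma isArtAlg_of_origin_pow_le [IsNoetherianRing Λ] {J : Ideal (MvPolynomial (Fin n) Λ)}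
    (hJ : J ≤ origin Λ n) {q : ℕ} (hq : origin Λ n ^ q ≤ J) :
    IsArtAlg Λ (CommAlgCat.of Λ (MvPolynomial (Fin n) Λ ⧸ J)) :=
  isArtAlg_quotient origin_isMaximal exists_sub_mem_origin hJ hq

end Origin

section Stage

variable {Λ : Type u} [CommRing Λ] [IsLocalRing Λ] {F : Art Λ ⥤ Type w} {n : ℕ}

variable (F n) in
/-- An element of `F` over an Artinian quotient `Λ[x₁, …, xₙ] ⧸ J` supported at the origin. -/
structure Stage where
  /-- The ideal `J`. -/
  ideal : ArtIdeal Λ (MvPolynomial (Fin n) Λ)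
  le_origin : (ideal : Ideal (MvPolynomial (Fin n) Λ)) ≤ origin Λ n
  exists_pow_le : ∃ q, origin Λ n ^ q ≤ (ideal : Ideal (MvPolynomial (Fin n) Λ))
  /-- The element of `F(Λ[x₁, …, xₙ] ⧸ J)`. -/
  elt : F.obj ideal.quot

namespace Stage

/-- `s'` is an extension of `s` to a larger quotient of the polynomial ring. -/
def IsLift (s' s : Stage F n) : Prop :=
  ∃ h : s'.ideal.1 ≤ s.ideal.1, F.map (ArtIdeal.factor h) s'.elt = s.elt

lemma IsLift.refl (s : Stage F n) : IsLift s s :=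
  ⟨le_rfl, by rw [ArtIdeal.factor_self, Functor.map_id_apply]⟩

lemma IsLift.trans {s₂ s₁ s₀ : Stage F n} (h : IsLift s₂ s₁) (h' : IsLift s₁ s₀) :
    IsLift s₂ s₀ := by
  obtain ⟨h₁, e₁⟩ := h
  obtain ⟨h₀, e₀⟩ := h'
  exact ⟨h₁.trans h₀, by rw [← e₀, ← e₁, ← Functor.map_comp_apply, ArtIdeal.factor_comp_factor]⟩

lemma IsLift.isTangentVersal {s' s : Stage F n} (h : IsLift s' s) (hs : IsTangentVersal s.elt) :
    IsTangentVersal s'.elt := by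
  obtain ⟨h, e⟩ := h
  intro v
  obtain ⟨l, hl⟩ := hs v
  exact ⟨ArtIdeal.factor h ≫ l, by rw [Functor.map_comp_apply, e, hl]⟩

/-- `s'` extends `s`, and its ideal is minimal among the ideals of the extensions of `s` that
contain `𝔐 J`, where `J` is the ideal of `s` and `𝔐` is the ideal of the origin. -/
structure IsMinimalLift (s' s : Stage F n) : Prop where
  isLift : IsLift s' s
  mul_le : origin Λ n * s.ideal.1 ≤ s'.ideal.1
  minimal : ∀ s'' : Stage F n, IsLift s'' s → origin Λ n * s.ideal.1 ≤ s''.ideal.1 →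
    s''.ideal.1 ≤ s'.ideal.1 → s'.ideal.1 ≤ s''.ideal.1

lemma exists_pow_le_mul (s : Stage F n) : ∃ q, origin Λ n ^ q ≤ origin Λ n * s.ideal.1 := by
  obtain ⟨q, hq⟩ := s.exists_pow_le
  exact ⟨q + 1, by rw [pow_succ']; exact Ideal.mul_mono_right hq⟩

lemma exists_isMinimalLift [IsNoetherianRing Λ] (s : Stage F n) :
    ∃ s' : Stage F n, IsMinimalLift s' s := by
  set I := origin Λ n * s.ideal.1
  obtain ⟨q, hq⟩ := s.exists_pow_le_mul
  obtain ⟨_, hart, -⟩ := isArtAlg_of_origin_pow_le (Ideal.mul_le_right.trans s.le_origin) hq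
  have hart : IsArtinianRing (MvPolynomial (Fin n) Λ ⧸ I) := hart
  obtain ⟨s', ⟨h₁, h₂⟩, h₃⟩ := (InvImage.wf
    (fun s' : Stage F n => s'.ideal.1.map (Ideal.Quotient.mk I)) wellFounded_lt).has_min
    {s' | IsLift s' s ∧ I ≤ s'.ideal.1} ⟨s, IsLift.refl s, Ideal.mul_le_right⟩
  refine ⟨s', h₁, h₂, fun s'' hl hI hle => ?_⟩
  have := (Ideal.map_mono (f := Ideal.Quotient.mk I) hle).eq_of_not_lt (h₃ s'' ⟨hl, hI⟩)
  rw [← Ideal.comap_map_mk hI, this, Ideal.comap_map_mk h₂]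

/-- Let `s'` be a minimal extension of `s`. A morphism `φ` from the quotient of `s` to `A` lifts
along a small extension `B → A`, after passing to the quotient of `s'`, as soon as the element of
`F(A)` induced by `φ` lifts to `F(B)`. -/
lemma IsMinimalLift.exists_hom [IsNoetherianRing Λ] [IsDeformationFunctor F] {s' s : Stage F n}
    (hs : IsMinimalLift s' s) {B A : Art Λ} {p : B ⟶ A} (hp : IsSmallExtension p)
    (φ : s.ideal.quot ⟶ A) (η : F.obj B) (h : F.map φ s.elt = F.map p η) :
    ∃ φ' : s'.ideal.quot ⟶ B, ∀ x,
      Art.toAlgHom p (Art.toAlgHom φ' (s'.ideal.mk x)) = Art.toAlgHom φ (s.ideal.mk x) := by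
  obtain ⟨hp₁, t, ht0, hker, ht⟩ := id hp
  let C := fiberProduct φ p
  let π₁ : C ⟶ s.ideal.quot := fiberFst φ p
  let π₂ : C ⟶ B := fiberSnd φ p
  have hpb : IsPullback π₁ π₂ φ p := fiberProduct_isPullback φ p
  obtain ⟨ζ, hζ⟩ := IsDeformationFunctor.h1 (F := F) hpb hp ⟨(s.elt, η), h⟩
  have hζ₁ : F.map π₁ ζ = s.elt := congrArg (fun y => y.1.1) hζ
  have hπ₁ : IsSurjection π₁ := fun a => by
    obtain ⟨b, hb⟩ := hp₁ (Art.toAlgHom φ a)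
    obtain ⟨x, hx, -⟩ := fiberProduct_existsUnique (f := φ) (g := p) a b hb.symm
    exact ⟨x, hx.1⟩
  obtain ⟨ψ, hψ⟩ := exists_algHom_lift hπ₁ s.ideal.mk
  -- The kernel of `C → Λ[x] ⧸ J` is spanned over `Λ` by `u = (0, t)`, and is killed by `𝔪_C`.
  have htp : Art.toAlgHom p t = 0 := by
    have : t ∈ RingHom.ker (Art.toAlgHom p) := hker ▸ Ideal.mem_span_singleton_self t
    exact this
  obtain ⟨u, ⟨hu₁, hu₂⟩, -⟩ := fiberProduct_existsUnique (f := φ) (g := p) 0 t (by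
    rw [htp, map_zero])
  have hext : ∀ x y : C.obj, Art.toAlgHom π₁ x = Art.toAlgHom π₁ y →
      Art.toAlgHom π₂ x = Art.toAlgHom π₂ y → x = y := fun x y h₁ h₂ =>
    (fiberProduct_existsUnique (f := φ) (g := p) (Art.toAlgHom π₁ y) (Art.toAlgHom π₂ y)
      (congrArg (fun f => Art.toAlgHom f y) hpb.w)).unique ⟨h₁, h₂⟩ ⟨rfl, rfl⟩
  have hmu : ∀ x ∈ maximalIdeal C.obj, x * u = 0 := fun x hx => hext _ _
    (by rw [map_mul, hu₁, mul_zero, map_zero])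
    (by rw [map_mul, hu₂, map_zero, ht _ ((Art.map_mem_maximalIdeal _).2 hx)])
  have hspan : ∀ x : C.obj, Art.toAlgHom π₁ x = 0 → ∃ r : Λ, x = algebraMap Λ C.obj r * u := by
    intro x hx
    have h₂ : Art.toAlgHom π₂ x ∈ Ideal.span {t} := by
      rw [← hker, RingHom.mem_ker]
      have := congrArg (fun f => Art.toAlgHom f x) hpb.w
      simp only [Art.toAlgHom_comp, hx, map_zero] at this
      exact this.symm
    obtain ⟨d, hd⟩ := Ideal.mem_span_singleton'.1 h₂
    obtain ⟨r, hr⟩ := B.exists_sub_mem d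
    refine ⟨r, hext _ _ (by rw [hx, map_mul, hu₁, mul_zero]) ?_⟩
    have := ht _ hr
    rw [sub_mul, sub_eq_zero, hd] at this
    rw [this, map_mul, hu₂, AlgHom.commutes]
  have hψm : ∀ x ∈ origin Λ n, ψ x ∈ maximalIdeal C.obj := fun x hx => by
    obtain ⟨q, hq⟩ := s.exists_pow_le
    rw [← Art.map_mem_maximalIdeal (Art.toAlgHom π₁), hψ]
    exact (map_mem_maximalIdeal_iff (f := s.ideal.mk)
      fun y hy => s.ideal.mk_eq_zero_iff.2 (hq hy)).2 hx
  have hψJ : ∀ x ∈ s.ideal.1, ∃ r : Λ, ψ x = algebraMap Λ C.obj r * u := fun x hx =>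
    hspan _ (by rw [hψ, s.ideal.mk_eq_zero_iff.2 hx])
  have hKJ : RingHom.ker ψ ≤ s.ideal.1 := fun x hx => by
    rw [RingHom.mem_ker] at hx
    refine s.ideal.mk_eq_zero_iff.1 ?_
    rw [← hψ, hx, map_zero]
  have hmulK : origin Λ n * s.ideal.1 ≤ RingHom.ker ψ := Ideal.mul_le.2 fun y hy x hx => by
    obtain ⟨r, hr⟩ := hψJ x hx
    rw [RingHom.mem_ker, map_mul, hr, mul_left_comm, hmu _ (hψm y hy), mul_zero]
  suffices hK : s'.ideal.1 ≤ RingHom.ker ψ by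
    refine ⟨s'.ideal.lift ((Art.toAlgHom π₂).comp ψ) fun x hx => ?_, fun x => ?_⟩
    · have h0 : ψ x = 0 := hK hx
      rw [RingHom.mem_ker, AlgHom.comp_apply, h0, map_zero]
    · have := congrArg (fun f => Art.toAlgHom f (ψ x)) hpb.w
      simp only [Art.toAlgHom_comp, hψ] at this
      exact this.symm
  -- Otherwise `ψ` is surjective, so that `C` is `Λ[x] ⧸ K` with `K = ker ψ`, and `s` extends to
  -- the quotient by the intersection of `K` and the ideal of `s'`, against minimality.
  by_contra hK
  obtain ⟨x, hxs', hxK⟩ := SetLike.not_le_iff_exists.1 hK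
  rw [RingHom.mem_ker] at hxK
  have hss' := hs.isLift.choose
  obtain ⟨r, hr⟩ := hψJ x (hss' hxs')
  have hru : IsUnit r := by
    by_contra hru
    exact hxK (by rw [hr, hmu _ (C.algebraMap_mem_maximalIdeal.2 hru)])
  obtain ⟨v, hv⟩ := hru.exists_left_inv
  have hux : ∀ y : C.obj, Art.toAlgHom π₁ y = 0 → ∃ z : Λ, y = ψ (MvPolynomial.C z * x) := by
    intro y hy
    obtain ⟨z, rfl⟩ := hspan y hy
    refine ⟨z * v, ?_⟩
    rw [map_mul ψ, hr, ← MvPolynomial.algebraMap_eq, AlgHom.commutes, ← mul_assoc, ← map_mul,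
      mul_assoc, hv, mul_one]
  have hsurj : Function.Surjective ψ := fun y => by
    obtain ⟨w, hw⟩ := s.ideal.mk_surjective (Art.toAlgHom π₁ y)
    obtain ⟨z, hz⟩ := hux (y - ψ w) (by rw [map_sub, hψ, hw, sub_self])
    exact ⟨MvPolynomial.C z * x + w, by rw [map_add, ← hz, sub_add_cancel]⟩
  obtain ⟨q, hq⟩ := s.exists_pow_le_mul
  let K : ArtIdeal Λ (MvPolynomial (Fin n) Λ) :=
    ⟨RingHom.ker ψ, isArtAlg_of_origin_pow_le (hKJ.trans s.le_origin) (hq.trans hmulK)⟩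
  obtain ⟨g, hg₁, hg₂⟩ := Art.exists_inverse_of_bijective (K.lift ψ le_rfl) (by
    refine ⟨?_, fun y => ?_⟩
    · rw [injective_iff_map_eq_zero]
      intro a ha
      obtain ⟨a, rfl⟩ := K.mk_surjective a
      exact K.mk_eq_zero_iff.2 ha
    · obtain ⟨a, ha⟩ := hsurj y
      exact ⟨K.mk a, ha⟩)
  have hK₂ : F.map (ArtIdeal.factor (J := K) (K := s.ideal) hKJ) (F.map g ζ) = s.elt := by
    have : K.lift ψ le_rfl ≫ π₁ = ArtIdeal.factor (J := K) (K := s.ideal) hKJ :=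
      ArtIdeal.hom_ext fun a => hψ a
    rw [← this, ← Functor.map_comp_apply, ← Category.assoc, hg₂, Category.id_comp, hζ₁]
  have hinf : origin Λ n * s.ideal.1 ≤ s'.ideal.1 ⊓ RingHom.ker ψ := le_inf hs.mul_le hmulK
  let I : ArtIdeal Λ (MvPolynomial (Fin n) Λ) :=
    ⟨s'.ideal.1 ⊓ RingHom.ker ψ, isArtAlg_of_origin_pow_le (inf_le_left.trans s'.le_origin)
      (hq.trans hinf)⟩
  have hsup : ∀ w ∈ s.ideal.1, ∃ z : Λ, w - MvPolynomial.C z * x ∈ RingHom.ker ψ := by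
    intro w hw
    obtain ⟨z, hz⟩ := hux (ψ w) (by rw [hψ, s.ideal.mk_eq_zero_iff.2 hw])
    exact ⟨z, by rw [RingHom.mem_ker, map_sub, ← hz, sub_self]⟩
  have hsmall : IsSmallExtension (ArtIdeal.factor (J := K) (K := s.ideal) hKJ) := by
    refine ArtIdeal.factor_isSmallExtension _ (hss' hxs') hxK (fun w hw => ?_) fun y hy => ?_
    · obtain ⟨z, hz⟩ := hsup w hw
      exact Submodule.mem_sup.2 ⟨_, hz, _, Ideal.mul_mem_left _ _
        (Ideal.mem_span_singleton_self x), sub_add_cancel _ _⟩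
    · refine hmulK (Ideal.mul_mem_mul ?_ (hss' hxs'))
      exact (map_mem_maximalIdeal_iff (f := K.mk)
        fun y hy => K.mk_eq_zero_iff.2 (hmulK (hq hy))).1 hy
  have hpb' := ArtIdeal.isPullback_inf (I := I) (J₁ := s'.ideal) (J₂ := K) (J := s.ideal) hss' hKJ
    (fun w hw => by
      obtain ⟨z, hz⟩ := hsup w hw
      exact Submodule.mem_sup.2 ⟨_, Ideal.mul_mem_left _ (MvPolynomial.C z) hxs', _, hz,
        add_sub_cancel _ _⟩) rfl
  obtain ⟨ξ, hξ⟩ := IsDeformationFunctor.h1 (F := F) hpb' hsmall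
    ⟨(s'.elt, F.map g ζ), hs.isLift.choose_spec.trans hK₂.symm⟩
  have hξ₁ : F.map _ ξ = s'.elt := congrArg (fun y => y.1.1) hξ
  have hmin := hs.minimal ⟨I, inf_le_left.trans s'.le_origin, ⟨q, hq.trans hinf⟩, ξ⟩
    (IsLift.trans ⟨inf_le_left, hξ₁⟩ hs.isLift) hinf inf_le_left
  exact hK (hmin.trans inf_le_right)

end Stage

end Stage

/-! ### Versality -/

section Versal

variable {Λ : Type u} [CommRing Λ] [IsLocalRing Λ] {F : Art Λ ⥤ Type w} {n : ℕ}

/-- A sequence of elements of `F` over quotients of a polynomial ring is versal along `p : B → A` if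
every solution of the lifting problem for `F` along `p` comes from a homomorphism: if `φ` is a
morphism to `A` and `η` in `F(B)` lifts the element of `F(A)` induced by `φ`, then `φ` lifts to a
morphism to `B` that induces `η`. The lift is defined at a later place of the sequence, which is
independent of `φ` and `η`. -/
def IsVersalAlong (σ : ℕ → Stage F n) {B A : Art Λ} (p : B ⟶ A) : Prop :=
  ∀ r, ∃ r', ∀ (φ : (σ r).ideal.quot ⟶ A) (η : F.obj B), F.map φ (σ r).elt = F.map p η →
    ∃ φ' : (σ r').ideal.quot ⟶ B, F.map φ' (σ r').elt = η ∧ ∀ x,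
      Art.toAlgHom p (Art.toAlgHom φ' ((σ r').ideal.mk x)) = Art.toAlgHom φ ((σ r).ideal.mk x)

namespace IsVersalAlong

variable {σ : ℕ → Stage F n} {C B A : Art Λ}

lemma comp {q : C ⟶ B} {p : B ⟶ A} (hq : IsVersalAlong σ q) (hp : IsVersalAlong σ p) :
    IsVersalAlong σ (q ≫ p) := by
  intro r
  obtain ⟨r₁, h₁⟩ := hp r
  obtain ⟨r₂, h₂⟩ := hq r₁
  refine ⟨r₂, fun φ η h => ?_⟩
  rw [Functor.map_comp_apply] at h
  obtain ⟨φ₁, e₁, c₁⟩ := h₁ φ _ h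
  obtain ⟨φ₂, e₂, c₂⟩ := h₂ φ₁ η e₁
  exact ⟨φ₂, e₂, fun x => by rw [Art.toAlgHom_comp, c₂, c₁]⟩

lemma of_bijective {p : B ⟶ A} (hp : Function.Bijective (Art.toAlgHom p)) :
    IsVersalAlong σ p := by
  intro r
  obtain ⟨g, hg₁, hg₂⟩ := Art.exists_inverse_of_bijective p hp
  refine ⟨r, fun φ η h => ⟨φ ≫ g, ?_, fun x => ?_⟩⟩
  · rw [Functor.map_comp_apply, h, ← Functor.map_comp_apply, hg₁, Functor.map_id_apply]
  · rw [← Art.toAlgHom_comp, Category.assoc, hg₂, Category.comp_id]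

variable [IsNoetherianRing Λ] [IsDeformationFunctor F]

lemma of_isSmallExtension (hσ : ∀ r, (σ (r + 1)).IsMinimalLift (σ r))
    (h0 : IsTangentVersal (σ 0).elt) {p : B ⟶ A} (hp : IsSmallExtension p) :
    IsVersalAlong σ p := by
  have htan : ∀ r, IsTangentVersal (σ r).elt := fun r => by
    induction r with
    | zero => exact h0
    | succ r ih => exact (hσ r).isLift.isTangentVersal ih
  refine fun r => ⟨r + 1, fun φ η h => ?_⟩
  obtain ⟨φ₁, h₁⟩ := (hσ r).exists_hom hp φ η h
  obtain ⟨hle, he⟩ := (hσ r).isLift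
  have hcomm : φ₁ ≫ p = ArtIdeal.factor hle ≫ φ := ArtIdeal.hom_ext h₁
  obtain ⟨φ', hφ', e⟩ := exists_hom_of_map_eq hp (htan (r + 1)) φ₁ η (by
    rw [← Functor.map_comp_apply, hcomm, Functor.map_comp_apply, he, h])
  refine ⟨φ', e, fun x => ?_⟩
  rw [← Art.toAlgHom_comp, hφ', hcomm]
  rfl

/-- Every surjection factors into small extensions: the quotients of `B` through which the
surjection factors with the property in question include one by a minimal ideal, which is zero. -/
lemma of_isSurjection (hσ : ∀ r, (σ (r + 1)).IsMinimalLift (σ r))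
    (h0 : IsTangentVersal (σ 0).elt) {p : B ⟶ A} (hp : IsSurjection p) :
    IsVersalAlong σ p := by
  obtain ⟨q, hq⟩ := (isArtinianRing_iff_isNilpotent_maximalIdeal B.obj).1 inferInstance
  have hart : ∀ K : Ideal B.obj, K ≤ RingHom.ker (Art.toAlgHom p) →
      IsArtAlg Λ (CommAlgCat.of Λ (B.obj ⧸ K)) := fun K hK =>
    isArtAlg_quotient (maximalIdeal.isMaximal B.obj) B.exists_sub_mem (q := q)
      (IsLocalRing.le_maximalIdeal (ne_top_of_le_ne_top (RingHom.ker_ne_top _) hK))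
      (hq.le.trans bot_le)
  let S : Set (Ideal B.obj) := {K | ∃ h : K ≤ RingHom.ker (Art.toAlgHom p),
    IsVersalAlong σ (ArtIdeal.lift ⟨K, hart K h⟩ (Art.toAlgHom p) h)}
  have hS : RingHom.ker (Art.toAlgHom p) ∈ S := by
    refine ⟨le_rfl, of_bijective ⟨?_, fun y => ?_⟩⟩
    · rw [injective_iff_map_eq_zero]
      intro a ha
      obtain ⟨a, rfl⟩ := ArtIdeal.mk_surjective _ a
      exact (ArtIdeal.mk_eq_zero_iff _).2 ha
    · obtain ⟨a, ha⟩ := hp y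
      exact ⟨ArtIdeal.mk _ a, ha⟩
  obtain ⟨K, ⟨hK, hvers⟩, hmin⟩ := wellFounded_lt.has_min S ⟨_, hS⟩
  let K₁ : ArtIdeal Λ B.obj := ⟨K, hart K hK⟩
  have hbot : K = ⊥ := by
    by_contra hne
    obtain ⟨K', -, hcov⟩ := exists_le_covBy_of_lt (bot_lt_iff_ne_bot.2 hne)
    let K₂ : ArtIdeal Λ B.obj := ⟨K', hart K' (hcov.le.trans hK)⟩
    obtain ⟨x, hxK, hxK'⟩ := SetLike.exists_of_lt hcov.lt
    have hgen : ∀ z ∈ K, z ∉ K' → K ≤ K' ⊔ Ideal.span {z} := fun z hz hz' => by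
      refine (hcov.eq_or_eq le_sup_left (sup_le hcov.le
        ((Ideal.span_singleton_le_iff_mem _).2 hz))).elim (fun h => ?_) fun h => h.ge
      exact absurd (h ▸ Ideal.mem_sup_right (Ideal.mem_span_singleton_self z)) hz'
    have hsmall : IsSmallExtension (ArtIdeal.factor (J := K₂) (K := K₁) hcov.le) := by
      refine ArtIdeal.factor_isSmallExtension _ hxK hxK' (hgen x hxK hxK') fun y hy => ?_
      have hy : y ∈ maximalIdeal B.obj := (Art.map_mem_maximalIdeal (B := K₂.quot) K₂.mk).1 hy
      by_contra hyx
      obtain ⟨k, hk, z, hz, hkz⟩ := Submodule.mem_sup.1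
        (hgen _ (Ideal.mul_mem_left _ y hxK) hyx hxK)
      obtain ⟨d, rfl⟩ := Ideal.mem_span_singleton'.1 hz
      have hu : IsUnit (1 - d * y) := by
        by_contra hu
        have h1 := add_mem ((mem_maximalIdeal _).2 hu) (Ideal.mul_mem_left _ d hy)
        rw [sub_add_cancel] at h1
        exact (Ideal.ne_top_iff_one _).1 (maximalIdeal.isMaximal B.obj).ne_top h1
      refine hxK' ((Ideal.unit_mul_mem_iff_mem K' hu).1 ?_)
      convert hk using 1
      linear_combination -hkz
    refine hmin K' ⟨hcov.le.trans hK, ?_⟩ hcov.lt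
    have hcomp := (of_isSmallExtension hσ h0 hsmall).comp hvers
    have he : ArtIdeal.factor (J := K₂) (K := K₁) hcov.le ≫ K₁.lift (Art.toAlgHom p) hK =
        K₂.lift (Art.toAlgHom p) (hcov.le.trans hK) := ArtIdeal.hom_ext fun _ => rfl
    rwa [he] at hcomp
  let π : B ⟶ K₁.quot := Art.ofAlgHom (B := K₁.quot) K₁.mk
  have hπ : IsVersalAlong σ π := of_bijective ⟨by
    rw [injective_iff_map_eq_zero]
    intro a ha
    have : a ∈ K := K₁.mk_eq_zero_iff.1 ha
    rwa [hbot] at this, K₁.mk_surjective⟩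
  exact hπ.comp hvers

end IsVersalAlong

end Versal

/-! ### The first member of a versal sequence -/

section Base

variable {Λ : Type u} [CommRing Λ] [IsLocalRing Λ]

section

variable {F : Art Λ ⥤ Type w} [IsDeformationFunctor F]

/-- Tangent vectors `v₁, …, vₙ` are the components of an element of `F(k[kⁿ]) = F(k[ε]) ^ n`. -/
lemma exists_push_proj_eq {n : ℕ} (v : Fin n → TangentSpace F) :
    ∃ z : F.obj (sqZero Λ (Fin n → ResidueField Λ)),
      ∀ i, TangentSpace.push (LinearMap.proj i) z = v i := by
  induction n with
  | zero =>
    exact ⟨F.map (sqZeroIncl _) (IsDeformationFunctor.singleton (F := F)).some.default,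
      fun i => i.elim0⟩
  | succ n ih =>
    obtain ⟨z, hz⟩ := ih fun i => v i.succ
    obtain ⟨t, ⟨h₁, h₂⟩, -⟩ := TangentSpace.existsUnique_pair z (v 0)
    let L : Fin (n + 1) → (Fin n → ResidueField Λ) × ResidueField Λ →ₗ[ResidueField Λ]
        ResidueField Λ :=
      Fin.cons (LinearMap.snd _ _ _) fun i => LinearMap.proj i ∘ₗ LinearMap.fst _ _ _
    refine ⟨F.map (sqZeroMap (LinearMap.pi L)) t, fun i => ?_⟩
    rw [TangentSpace.push_push, LinearMap.proj_pi]
    refine Fin.cases ?_ (fun i => ?_) i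
    · exact h₂
    · rw [← hz i, ← h₁, TangentSpace.push_push]
      rfl

lemma exists_isTangentVersal_sqZero [FiniteDimensional (ResidueField Λ) (TangentSpace F)] :
    ∃ (n : ℕ) (z : F.obj (sqZero Λ (Fin n → ResidueField Λ))), IsTangentVersal z := by
  let b := Module.finBasis (ResidueField Λ) (TangentSpace F)
  obtain ⟨z, hz⟩ := exists_push_proj_eq b
  refine ⟨_, z, fun v => ?_⟩
  let P : ((Fin _ → ResidueField Λ) →ₗ[ResidueField Λ] ResidueField Λ) →ₗ[ResidueField Λ]
      TangentSpace F :=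
    { toFun := fun L => TangentSpace.push L z
      map_add' := fun L M => TangentSpace.push_add L M z
      map_smul' := fun c L => TangentSpace.push_smul c L z }
  refine ⟨sqZeroMap (∑ i, b.repr v i • LinearMap.proj i), ?_⟩
  change P _ = v
  rw [map_sum]
  refine Eq.trans (Finset.sum_congr rfl fun i _ => ?_) (b.sum_repr v)
  rw [map_smul]
  exact congrArg _ (hz i)

end

variable {n : ℕ}

variable (Λ n) in
/-- The homomorphism `Λ[x₁, …, xₙ] → k[kⁿ]` that sends `xᵢ` to the `i`-th basis vector. Its second
component is the linear part at the origin, reduced modulo `𝔪`. -/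
def linearPart : MvPolynomial (Fin n) Λ →ₐ[Λ]
    TrivSqZeroExt (ResidueField Λ) (Fin n → ResidueField Λ) :=
  MvPolynomial.aeval fun i => TrivSqZeroExt.inr (Pi.single i 1)

lemma linearPart_fst {a : Fin n → Λ} (ha : ∀ i, a i ∈ maximalIdeal Λ)
    (f : MvPolynomial (Fin n) Λ) :
    (linearPart Λ n f).fst = residue Λ (MvPolynomial.eval a f) := by
  induction f using MvPolynomial.induction_on with
  | C r =>
    rw [← MvPolynomial.algebraMap_eq, AlgHom.commutes, TrivSqZeroExt.algebraMap_eq_inl',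
      MvPolynomial.algebraMap_eq, MvPolynomial.eval_C]
    rfl
  | add f g hf hg => rw [map_add, map_add, map_add, TrivSqZeroExt.fst_add, hf, hg]
  | mul_X f i hf =>
    have : residue Λ (a i) = 0 := (residue_eq_zero_iff _).2 (ha i)
    simp [linearPart, this]

lemma linearPart_surjective : Function.Surjective (linearPart Λ n) := by
  intro y
  obtain ⟨r, hr⟩ := residue_surjective y.fst
  choose s hs using fun i => residue_surjective (y.snd i)
  refine ⟨MvPolynomial.C r + ∑ i, MvPolynomial.C (s i) * MvPolynomial.X i, ?_⟩
  have hC : ∀ r, linearPart Λ n (MvPolynomial.C r) = TrivSqZeroExt.inl (residue Λ r) := fun r => by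
    rw [← MvPolynomial.algebraMap_eq, AlgHom.commutes]
    rfl
  have hX : ∀ i, linearPart Λ n (MvPolynomial.X i) = TrivSqZeroExt.inr (Pi.single i 1) := fun i =>
    MvPolynomial.aeval_X _ i
  have hsum : ∑ i, residue Λ (s i) • (Pi.single i 1 : Fin n → ResidueField Λ) = y.snd := by
    ext j
    simp [hs, Pi.single_apply]
  simp only [map_add, map_sum, map_mul, hC, hX, TrivSqZeroExt.inl_mul_inr]
  rw [← TrivSqZeroExt.inr_sum, hsum, hr, TrivSqZeroExt.inl_fst_add_inr_snd_eq]

/-- The values of `f` at two points that agree modulo `𝔪 ^ l` differ modulo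
`𝔪 ^ (l + 1)` by the linear part of `f`. -/
lemma exists_eval_sub_eval_mem {l : ℕ} {a b : Fin n → Λ}
    (ha : ∀ i, a i ∈ maximalIdeal Λ) (hb : ∀ i, b i ∈ maximalIdeal Λ)
    (hab : ∀ i, b i - a i ∈ maximalIdeal Λ ^ l) (f : MvPolynomial (Fin n) Λ) :
    ∃ c : Fin n → Λ, (∀ i, residue Λ (c i) = (linearPart Λ n f).snd i) ∧
      MvPolynomial.eval b f - MvPolynomial.eval a f - ∑ i, c i * (b i - a i) ∈
        maximalIdeal Λ ^ (l + 1) := by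
  induction f using MvPolynomial.induction_on with
  | C r =>
    refine ⟨0, fun i => ?_, by simp⟩
    rw [← MvPolynomial.algebraMap_eq, AlgHom.commutes, TrivSqZeroExt.algebraMap_eq_inl']
    simp
  | add f g hf hg =>
    obtain ⟨c, hc, hf⟩ := hf
    obtain ⟨d, hd, hg⟩ := hg
    refine ⟨c + d, fun i => by simp [hc, hd], ?_⟩
    convert add_mem hf hg using 1
    simp only [map_add, Pi.add_apply, add_mul, Finset.sum_add_distrib]
    ring
  | mul_X f j hf =>
    obtain ⟨c, hc, hf⟩ := hf
    refine ⟨Pi.single j (MvPolynomial.eval a f), fun i => ?_, ?_⟩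
    · rw [map_mul, TrivSqZeroExt.snd_mul, linearPart_fst ha]
      simp only [linearPart, MvPolynomial.aeval_X, Pi.single_apply]
      split_ifs with h <;> simp [h]
    · have h₁ : MvPolynomial.eval b f - MvPolynomial.eval a f ∈ maximalIdeal Λ ^ l := by
        have := Ideal.pow_le_pow_right l.le_succ hf
        rw [← sub_add_cancel (MvPolynomial.eval b f - _) (∑ i, c i * (b i - a i))]
        exact add_mem this (sum_mem fun i _ => Ideal.mul_mem_left _ _ (hab i))
      have h₂ := Ideal.mul_mem_mul h₁ (hb j)
      rw [← pow_succ] at h₂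
      convert h₂ using 1
      simp [Pi.single_apply]
      ring

lemma eval_mem_of_linearPart_eq_zero {l : ℕ} {a b : Fin n → Λ}
    (ha : ∀ i, a i ∈ maximalIdeal Λ) (hb : ∀ i, b i ∈ maximalIdeal Λ)
    (hab : ∀ i, b i - a i ∈ maximalIdeal Λ ^ l) {f : MvPolynomial (Fin n) Λ}
    (hf : linearPart Λ n f = 0) (h : MvPolynomial.eval b f ∈ maximalIdeal Λ ^ (l + 1)) :
    MvPolynomial.eval a f ∈ maximalIdeal Λ ^ (l + 1) := by
  obtain ⟨c, hc, hc'⟩ := exists_eval_sub_eval_mem ha hb hab f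
  have hsum : ∑ i, c i * (b i - a i) ∈ maximalIdeal Λ ^ (l + 1) := sum_mem fun i _ => by
    rw [pow_succ']
    refine Ideal.mul_mem_mul ((residue_eq_zero_iff _).1 ?_) (hab i)
    rw [hc, hf]
    rfl
  have := sub_mem (sub_mem h hc') hsum
  convert this using 1
  ring

/-- The first member of a versal sequence: its quotient is `k[kⁿ]`, and it induces all tangent
vectors. -/
lemma exists_stage [IsNoetherianRing Λ] {F : Art Λ ⥤ Type w} [IsDeformationFunctor F]
    [FiniteDimensional (ResidueField Λ) (TangentSpace F)] :
    ∃ (n : ℕ) (s : Stage F n), IsTangentVersal s.elt ∧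
      s.ideal.1 = RingHom.ker (linearPart Λ n) := by
  obtain ⟨n, z, hz⟩ := exists_isTangentVersal_sqZero (F := F)
  let θ : MvPolynomial (Fin n) Λ →ₐ[Λ] (sqZero Λ (Fin n → ResidueField Λ)).obj := linearPart Λ n
  have hfst : ∀ f, (linearPart Λ n f).fst = residue Λ (MvPolynomial.constantCoeff f) := fun f => by
    rw [linearPart_fst (a := 0) fun _ => zero_mem _, MvPolynomial.eval_zero]
  have hle : RingHom.ker θ ≤ origin Λ n := fun f hf => by
    have hf : linearPart Λ n f = 0 := hf
    rw [mem_origin, ← residue_eq_zero_iff, ← hfst, hf]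
    rfl
  obtain ⟨q, hq⟩ := exists_origin_pow_le_ker (f := θ) fun x hx => by
    rw [mem_origin, ← residue_eq_zero_iff, ← hfst] at hx
    rw [mem_maximalIdeal, mem_nonunits_iff]
    change ¬ IsUnit (linearPart Λ n x)
    rw [TrivSqZeroExt.isUnit_iff_isUnit_fst, hx]
    exact not_isUnit_zero
  let J : ArtIdeal Λ (MvPolynomial (Fin n) Λ) := ⟨_, isArtAlg_of_origin_pow_le hle hq⟩
  obtain ⟨g, hg₁, hg₂⟩ := Art.exists_inverse_of_bijective (J.lift θ le_rfl) (by
    refine ⟨?_, fun y => ?_⟩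
    · rw [injective_iff_map_eq_zero]
      intro a ha
      obtain ⟨a, rfl⟩ := J.mk_surjective a
      exact J.mk_eq_zero_iff.2 ha
    · obtain ⟨a, ha⟩ := linearPart_surjective y
      exact ⟨J.mk a, ha⟩)
  refine ⟨n, ⟨J, hle, ⟨q, hq⟩, F.map g z⟩, fun v => ?_, rfl⟩
  obtain ⟨l, hl⟩ := hz v
  refine ⟨J.lift θ le_rfl ≫ l, ?_⟩
  change F.map _ (F.map g z) = v
  rw [← Functor.map_comp_apply, ← Category.assoc, hg₂, Category.id_comp, hl]

end Base

/-! ### Valuations of polynomial values -/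

section Valuation

variable {Λ : Type u} [CommRing Λ] {ν : Λ → ℕ∞}

namespace IsNontrivialValuation

lemma map_one [Nontrivial Λ] (hν : IsNontrivialValuation ν) : ν 1 = 0 := by
  have h1 : ν 1 ≠ ⊤ := fun h => by
    have : (1 : Λ) ∈ ν ⁻¹' {⊤} := h
    rw [hν.preimage_top] at this
    exact one_ne_zero this
  have h := hν.map_mul 1 1
  rw [mul_one] at h
  generalize ν 1 = x at *
  induction x with
  | top => exact absurd rfl h1
  | coe x => norm_cast at *; omega

lemma map_pow [Nontrivial Λ] (hν : IsNontrivialValuation ν) (a : Λ) (n : ℕ) :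
    ν (a ^ n) = n * ν a := by
  induction n with
  | zero => simp [hν.map_one]
  | succ n ih => rw [pow_succ, hν.map_mul, ih]; push_cast; ring

/-- An element of finite value can be cancelled at the cost of its value. -/
lemma mem_filtration_of_mul_mem (hν : IsNontrivialValuation ν) {c x : Λ} {m n : ℕ}
    (hc : ν c = m) (h : c * x ∈ hν.filtration (m + n)) : x ∈ hν.filtration n := by
  change ((m + n : ℕ) : ℕ∞) ≤ ν (c * x) at h
  change (n : ℕ∞) ≤ ν x
  rw [hν.map_mul, hc] at h
  generalize ν x = y at *
  induction y with
  | top => exact le_top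
  | coe y => norm_cast at *; omega

lemma filtration_anti (hν : IsNontrivialValuation ν) {m n : ℕ} (h : m ≤ n) :
    hν.filtration n ≤ hν.filtration m := fun a (ha : (n : ℕ∞) ≤ ν a) =>
  show (m : ℕ∞) ≤ ν a from (Nat.cast_le.2 h).trans ha

/-- A coefficient of a polynomial is small if the polynomial takes small values at sufficiently many
powers of an element `t` of positive value. -/
lemma exists_coeff_mem [Nontrivial Λ] (hν : IsNontrivialValuation ν) {t : Λ} {τ : ℕ}
    (ht : ν t = τ) (hτ : τ ≠ 0) (j M : ℕ) :
    ∃ r S : ℕ, ∀ g : Polynomial Λ,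
      (∀ s ≤ S, g.eval (t ^ (s + 1)) ∈ hν.filtration r) → g.coeff j ∈ hν.filtration M := by
  have hpow : ∀ s : ℕ, ν (t ^ s) = ((s * τ : ℕ) : ℕ∞) := fun s => by
    rw [hν.map_pow, ht, Nat.cast_mul]
  have hdiv : ∀ (g : Polynomial Λ) (x : Λ), g.eval x = x * g.divX.eval x + g.coeff 0 := by
    intro g x
    have h := congrArg (Polynomial.eval x) g.X_mul_divX_add.symm
    rwa [Polynomial.eval_add, Polynomial.eval_mul, Polynomial.eval_X, Polynomial.eval_C] at h
  -- The constant term is congruent to the value at `t ^ (M + 1)`.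
  have h0 : ∀ M : ℕ, ∀ g : Polynomial Λ, g.eval (t ^ (M + 1)) ∈ hν.filtration M →
      g.coeff 0 ∈ hν.filtration M := by
    intro M g hg
    rw [hdiv] at hg
    refine (Ideal.add_mem_iff_right _ (Ideal.mul_mem_right _ _ ?_)).1 hg
    change (M : ℕ∞) ≤ ν (t ^ (M + 1))
    rw [hpow]
    exact Nat.cast_le.2 (by nlinarith [Nat.pos_of_ne_zero hτ])
  induction j with
  | zero => exact ⟨M, M, fun g hg => h0 M g (hg M le_rfl)⟩
  | succ j ih =>
    obtain ⟨r, S, h⟩ := ih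
    -- Subtract the constant term and divide by `t ^ (s + 1)`, which costs `(s + 1) * τ`.
    set R := (S + 1) * τ + r with hR
    refine ⟨R, max R S, fun g hg => ?_⟩
    rw [← Polynomial.coeff_divX]
    refine h _ fun s hs => ?_
    have h1 : t ^ (s + 1) * g.divX.eval (t ^ (s + 1)) ∈ hν.filtration R := by
      have h2 := hg s (hs.trans (le_max_right _ _))
      rw [hdiv] at h2
      exact (Ideal.add_mem_iff_left _ (h0 R g (hg R (le_max_left _ _)))).1 h2
    refine hν.mem_filtration_of_mul_mem (hpow (s + 1)) (hν.filtration_anti ?_ h1)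
    rw [hR]
    gcongr

/-- A coefficient of a polynomial is small if all values of the polynomial on `I ^ n` are small,
where `I` is an ideal that contains an element of positive finite value. -/
lemma exists_mvCoeff_mem [Nontrivial Λ] (hν : IsNontrivialValuation ν) {I : Ideal Λ} {t : Λ}
    (htI : t ∈ I) {τ : ℕ} (ht : ν t = τ) (hτ : τ ≠ 0) {n : ℕ} (α : Fin n →₀ ℕ) (M : ℕ) :
    ∃ r : ℕ, ∀ f : MvPolynomial (Fin n) Λ,
      (∀ a : Fin n → Λ, (∀ i, a i ∈ I) → MvPolynomial.eval a f ∈ hν.filtration r) →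
        f.coeff α ∈ hν.filtration M := by
  induction n generalizing M with
  | zero =>
    refine ⟨M, fun f hf => ?_⟩
    rw [Subsingleton.elim α 0]
    have := hf 0 fun i => i.elim0
    rwa [MvPolynomial.eq_C_of_isEmpty f, MvPolynomial.eval_C] at this
  | succ n ih =>
    obtain ⟨r, hr⟩ := ih α.tail M
    obtain ⟨R, S, hR⟩ := hν.exists_coeff_mem ht hτ (α 0) r
    refine ⟨R, fun f hf => ?_⟩
    rw [← Finsupp.cons_tail α, ← MvPolynomial.finSuccEquiv_coeff_coeff]
    refine hr _ fun a ha => ?_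
    rw [← MvPolynomial.coeff_eval_eq_eval_coeff]
    refine hR _ fun s _ => ?_
    rw [← MvPolynomial.eval_eq_eval_mv_eval']
    refine hf _ fun i => ?_
    refine Fin.cases ?_ (fun k => ?_) i
    · exact I.pow_mem_of_mem htI _ s.succ_pos
    · exact ha k

/-- An element which is neither zero nor of value zero has positive finite value, and is not a
unit. -/
lemma exists_mem_maximalIdeal [IsLocalRing Λ] (hν : IsNontrivialValuation ν) :
    ∃ t ∈ maximalIdeal Λ, ∃ τ : ℕ, ν t = τ ∧ τ ≠ 0 := by
  obtain ⟨_, ⟨t, rfl⟩, ht⟩ := hν.nontrivial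
  simp only [Set.mem_insert_iff, Set.mem_singleton_iff, not_or] at ht
  obtain ⟨τ, hτ⟩ := ENat.ne_top_iff_exists.1 ht.2
  refine ⟨t, ?_, τ, hτ.symm, fun h => ht.1 (by rw [← hτ, h]; rfl)⟩
  rw [mem_maximalIdeal, mem_nonunits_iff]
  intro hu
  obtain ⟨v, hv⟩ := hu.exists_right_inv
  have := hν.map_mul t v
  rw [hv, hν.map_one] at this
  exact ht.1 (add_eq_zero.1 this.symm).1

end IsNontrivialValuation

namespace IsCompatibleValuation

lemma exists_filtration_le [IsLocalRing Λ] (hν : IsNontrivialValuation ν)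
    (h : (maximalIdeal Λ).adicTopology = hν.topology) (q : ℕ) :
    ∃ M, hν.filtration M ≤ maximalIdeal Λ ^ q := by
  have h1 := (maximalIdeal Λ).hasBasis_nhds_zero_adic.mem_of_mem (i := q) trivial
  rw [h] at h1
  obtain ⟨M, -, hM⟩ := (RingSubgroupsBasis.hasBasis_nhds_zero _).mem_iff.1 h1
  exact ⟨M, hM⟩

lemma exists_pow_le [IsLocalRing Λ] (hν : IsNontrivialValuation ν)
    (h : (maximalIdeal Λ).adicTopology = hν.topology) (M : ℕ) :
    ∃ r, maximalIdeal Λ ^ r ≤ hν.filtration M := by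
  have h1 := (RingSubgroupsBasis.hasBasis_nhds_zero
    hν.filtration_basis.toRing_subgroups_basis).mem_of_mem (i := M) trivial
  change _ ∈ @nhds Λ hν.topology 0 at h1
  rw [← h] at h1
  obtain ⟨r, -, hr⟩ := (maximalIdeal Λ).hasBasis_nhds_zero_adic.mem_iff.1 h1
  exact ⟨r, hr⟩

end IsCompatibleValuation

/-- A coefficient of a polynomial lies in a given power of the maximal ideal `𝔪` if all values of
the polynomial on `𝔪 ^ n` lie in a sufficiently high power of `𝔪`. -/
lemma IsCompatibleValuation.exists_coeff_mem_pow [IsLocalRing Λ] (hν : IsCompatibleValuation ν)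
    {n : ℕ} (α : Fin n →₀ ℕ) (q : ℕ) :
    ∃ r : ℕ, ∀ f : MvPolynomial (Fin n) Λ,
      (∀ a : Fin n → Λ, (∀ i, a i ∈ maximalIdeal Λ) →
        MvPolynomial.eval a f ∈ maximalIdeal Λ ^ r) → f.coeff α ∈ maximalIdeal Λ ^ q := by
  obtain ⟨hν, h⟩ := hν
  obtain ⟨t, htm, τ, ht, hτ⟩ := hν.exists_mem_maximalIdeal
  obtain ⟨M, hM⟩ := exists_filtration_le hν h q
  obtain ⟨R, hR⟩ := hν.exists_mvCoeff_mem htm ht hτ α M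
  obtain ⟨r, hr⟩ := exists_pow_le hν h R
  exact ⟨r, fun f hf => hM (hR f fun a ha => hr (hf a ha))⟩

end Valuation

/-! ### Values of the polynomials in a versal sequence -/

section Final

variable {Λ : Type u} [CommRing Λ] [IsLocalRing Λ] {n : ℕ}

lemma mem_origin_pow {q : ℕ} {f : MvPolynomial (Fin n) Λ}
    (h : ∀ α : Fin n →₀ ℕ, α.degree < q → f.coeff α ∈ maximalIdeal Λ ^ q) :
    f ∈ origin Λ n ^ q := by
  have hX : MvPolynomial.idealOfVars (Fin n) Λ ≤ origin Λ n := by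
    rw [MvPolynomial.idealOfVars, Ideal.span_le]
    rintro _ ⟨i, rfl⟩
    rw [SetLike.mem_coe, mem_origin, MvPolynomial.constantCoeff_X]
    exact zero_mem _
  have hC : (maximalIdeal Λ).map (MvPolynomial.C (σ := Fin n)) ≤ origin Λ n :=
    Ideal.map_le_iff_le_comap.2 fun r hr => by
      rwa [Ideal.mem_comap, mem_origin, MvPolynomial.constantCoeff_C]
  rw [f.as_sum]
  refine sum_mem fun α _ => ?_
  by_cases hα : α.degree < q
  · rw [← mul_one (f.coeff α), ← MvPolynomial.C_mul_monomial]
    have := Ideal.mem_map_of_mem (MvPolynomial.C (σ := Fin n)) (h α hα)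
    rw [Ideal.map_pow] at this
    exact Ideal.mul_mem_right _ _ (Ideal.pow_right_mono hC q this)
  · refine Ideal.pow_right_mono hX q ?_
    rw [MvPolynomial.mem_pow_idealOfVars_iff]
    intro β hβ
    rw [Finset.mem_singleton.1 (MvPolynomial.support_monomial_subset hβ)]
    exact not_lt.1 hα

/-- A polynomial lies in a given power of the ideal of the origin if all its values on `𝔪 ^ n` lie
in a sufficiently high power of `𝔪`. -/
lemma IsCompatibleValuation.exists_mem_origin_pow {ν : Λ → ℕ∞} (hν : IsCompatibleValuation ν)
    (q : ℕ) : ∃ r : ℕ, ∀ f : MvPolynomial (Fin n) Λ,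
      (∀ a : Fin n → Λ, (∀ i, a i ∈ maximalIdeal Λ) →
        MvPolynomial.eval a f ∈ maximalIdeal Λ ^ r) → f ∈ origin Λ n ^ q := by
  choose r hr using fun α : Fin n →₀ ℕ => hν.exists_coeff_mem_pow α q
  have hfin := Finsupp.finite_of_degree_lt (σ := Fin n) q
  refine ⟨hfin.toFinset.sup r, fun f hf => mem_origin_pow fun α hα => hr α f fun a ha => ?_⟩
  exact Ideal.pow_le_pow_right (Finset.le_sup (f := r) (hfin.mem_toFinset.2 hα)) (hf a ha)

variable {F : Art Λ ⥤ Type w} {σ : ℕ → Stage F n}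

lemma Stage.ideal_antitone (hσ : ∀ r, (σ (r + 1)).IsMinimalLift (σ r)) :
    Antitone fun r => (σ r).ideal.1 :=
  antitone_nat_of_succ_le fun r => (hσ r).isLift.choose

variable [IsNoetherianRing Λ] [IsDeformationFunctor F]

/-- If `F(Λ ⧸ 𝔪 ^ (l + 1)) → F(Λ ⧸ 𝔪 ^ l)` is surjective for all `l`, then the polynomials in the
ideals of a versal sequence take arbitrarily small values on `𝔪 ^ n`. For if `a` defines a
homomorphism to `Λ ⧸ 𝔪 ^ l`, then some `b ≡ a` modulo `𝔪 ^ l` defines one to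
`Λ ⧸ 𝔪 ^ (l + 1)`; and then so does `a`, since the ideals have no linear part. -/
lemma exists_eval_mem_pow (hσ : ∀ r, (σ (r + 1)).IsMinimalLift (σ r))
    (h0 : IsTangentVersal (σ 0).elt) (h1 : (σ 0).ideal.1 = RingHom.ker (linearPart Λ n))
    (hF : ∀ (l : ℕ) [NeZero l], Function.Surjective (F.map (quotPowProj Λ l))) (l : ℕ) :
    ∃ r, ∀ f ∈ (σ r).ideal.1, ∀ a : Fin n → Λ, (∀ i, a i ∈ maximalIdeal Λ) →
      MvPolynomial.eval a f ∈ maximalIdeal Λ ^ (l + 1) := by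
  have hker : ∀ r, ∀ f ∈ (σ r).ideal.1, linearPart Λ n f = 0 := fun r f hf => by
    have hf : f ∈ (σ 0).ideal.1 := Stage.ideal_antitone hσ (Nat.zero_le r) hf
    rwa [h1] at hf
  induction l with
  | zero =>
    refine ⟨0, fun f hf a ha => ?_⟩
    rw [zero_add, pow_one, ← residue_eq_zero_iff, ← linearPart_fst ha, hker 0 f hf]
    rfl
  | succ l ih =>
    obtain ⟨r, hr⟩ := ih
    have hsurj : IsSurjection (quotPowProj Λ (l + 1)) :=
      Ideal.Quotient.factor_surjective (Ideal.pow_le_pow_right (l + 1).le_succ)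
    obtain ⟨r', hr'⟩ := IsVersalAlong.of_isSurjection hσ h0 hsurj r
    refine ⟨r', fun f hf a ha => ?_⟩
    have heval : ∀ (m : ℕ) [NeZero m] (c : Fin n → Λ) (g : MvPolynomial (Fin n) Λ),
        MvPolynomial.aeval (fun i => algebraMap Λ (quotPow Λ m).obj (c i)) g =
          algebraMap Λ (quotPow Λ m).obj (MvPolynomial.eval c g) := fun m _ c g =>
      MvPolynomial.aeval_algebraMap_apply _ c g
    have hzero : ∀ (m : ℕ) [NeZero m] (c : Λ), algebraMap Λ (quotPow Λ m).obj c = 0 ↔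
        c ∈ maximalIdeal Λ ^ m := fun m _ c => Ideal.Quotient.eq_zero_iff_mem
    let φ : (σ r).ideal.quot ⟶ quotPow Λ (l + 1) := (σ r).ideal.lift
      (MvPolynomial.aeval fun i => algebraMap Λ (quotPow Λ (l + 1)).obj (a i)) fun g hg => by
        rw [RingHom.mem_ker, heval, hzero]
        exact hr g hg a ha
    obtain ⟨η, hη⟩ := hF (l + 1) (F.map φ (σ r).elt)
    obtain ⟨φ', -, hφ'⟩ := hr' φ η hη.symm
    have hmk : Function.Surjective (algebraMap Λ (quotPow Λ (l + 1 + 1)).obj) :=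
      Ideal.Quotient.mk_surjective
    choose b hb using fun i => hmk (Art.toAlgHom φ' ((σ r').ideal.mk (MvPolynomial.X i)))
    have hφb : ∀ g, Art.toAlgHom φ' ((σ r').ideal.mk g) =
        algebraMap Λ (quotPow Λ (l + 1 + 1)).obj (MvPolynomial.eval b g) := fun g => by
      rw [← heval]
      refine DFunLike.congr_fun (f := (Art.toAlgHom φ').comp (σ r').ideal.mk)
        (MvPolynomial.algHom_ext fun i => ?_) g
      rw [MvPolynomial.aeval_X, hb]
      rfl
    have hab : ∀ i, b i - a i ∈ maximalIdeal Λ ^ (l + 1) := fun i => by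
      have h := hφ' (MvPolynomial.X i)
      rw [← hb, AlgHom.commutes, ArtIdeal.lift_mk, MvPolynomial.aeval_X] at h
      rw [← hzero, map_sub, h, sub_self]
    have hbm : ∀ i, b i ∈ maximalIdeal Λ := fun i => by
      rw [← sub_add_cancel (b i) (a i)]
      exact add_mem (Ideal.pow_le_self l.succ_ne_zero (hab i)) (ha i)
    refine eval_mem_of_linearPart_eq_zero ha hbm hab (hker r' f hf) ?_
    rw [← hzero, ← hφb, (σ r').ideal.mk_eq_zero_iff.2 hf, map_zero]

/-- Versality along `A → k` induces every element of `F(A)` by a morphism to `A`, which lifts to `B`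
from the polynomial ring, and then from one of the quotients in the sequence. -/
lemma exists_map_eq_of_isSurjection (hσ : ∀ r, (σ (r + 1)).IsMinimalLift (σ r))
    (h0 : IsTangentVersal (σ 0).elt)
    (hpow : ∀ q, ∃ r, (σ r).ideal.1 ≤ origin Λ n ^ q) {B A : Art Λ} {p : B ⟶ A}
    (hp : IsSurjection p) : Function.Surjective (F.map p) := by
  intro η
  obtain ⟨i⟩ := IsDeformationFunctor.singleton (F := F)
  have hk : IsSurjection A.toResField := fun y => by
    obtain ⟨r, rfl⟩ := residue_surjective (R := Λ) y
    exact ⟨algebraMap Λ A.obj r, AlgHom.commutes _ r⟩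
  obtain ⟨r, hr⟩ := IsVersalAlong.of_isSurjection hσ h0 hk 0
  obtain ⟨φ, hφ, -⟩ := hr (σ 0).ideal.quot.toResField η (Subsingleton.elim _ _)
  obtain ⟨g, hg⟩ := exists_algHom_lift hp ((Art.toAlgHom φ).comp (σ r).ideal.mk)
  obtain ⟨q, hq⟩ := (σ r).exists_pow_le
  -- The lift `g` of `φ` to the polynomial ring kills a power of the ideal of the origin.
  obtain ⟨m, hm⟩ := exists_origin_pow_le_ker (f := g) fun x hx => by
    rw [← Art.map_mem_maximalIdeal (Art.toAlgHom p), hg, AlgHom.comp_apply,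
      Art.map_mem_maximalIdeal]
    exact (map_mem_maximalIdeal_iff (f := (σ r).ideal.mk)
      fun y hy => (σ r).ideal.mk_eq_zero_iff.2 (hq hy)).2 hx
  obtain ⟨r', hr'⟩ := hpow m
  have hlift : ∀ k, (σ (r + k)).IsLift (σ r) := fun k => by
    induction k with
    | zero => exact Stage.IsLift.refl _
    | succ k ih => exact (hσ (r + k)).isLift.trans ih
  obtain ⟨hle, he⟩ := hlift r'
  let g' := (σ (r + r')).ideal.lift g
    ((Stage.ideal_antitone hσ (Nat.le_add_left r' r)).trans (hr'.trans hm))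
  have hg' : g' ≫ p = ArtIdeal.factor hle ≫ φ := ArtIdeal.hom_ext hg
  refine ⟨F.map g' (σ (r + r')).elt, ?_⟩
  rw [← Functor.map_comp_apply, hg', Functor.map_comp_apply, he, hφ]

end Final

end

end Deformation


theorem proposition2p6 (Λ : Type u) [CommRing Λ] [IsDomain Λ] [IsLocalRing Λ] [IsNoetherianRing Λ]
    [IsAdicComplete (IsLocalRing.maximalIdeal Λ) Λ]
    (hν : ∃ ν : Λ → ℕ∞, Deformation.IsCompatibleValuation ν)
    (F : Deformation.Art Λ ⥤ Type w) [Deformation.IsDeformationFunctor F]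
    [FiniteDimensional (IsLocalRing.ResidueField Λ) (Deformation.TangentSpace F)]
    (hF : ∀ (ℓ : ℕ) [NeZero ℓ], Function.Surjective (F.map (Deformation.quotPowProj Λ ℓ))) :
    Deformation.IsSmooth F := by
  obtain ⟨ν, hν⟩ := hν
  obtain ⟨n, s, hs, hker⟩ := Deformation.exists_stage (F := F)
  choose next hnext using Deformation.Stage.exists_isMinimalLift (F := F) (n := n)
  let σ : ℕ → Deformation.Stage F n := fun r => next^[r] s
  have hσ : ∀ r, (σ (r + 1)).IsMinimalLift (σ r) := fun r => by
    change (next^[r + 1] s).IsMinimalLift _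
    rw [Function.iterate_succ_apply']
    exact hnext _
  have hpow : ∀ q, ∃ r, (σ r).ideal.1 ≤ Deformation.origin Λ n ^ q := fun q => by
    obtain ⟨l, hl⟩ := hν.exists_mem_origin_pow (n := n) q
    obtain ⟨r, hr⟩ := Deformation.exists_eval_mem_pow hσ hs hker hF l
    exact ⟨r, fun f hf => hl f fun a ha => Ideal.pow_le_pow_right l.le_succ (hr f hf a ha)⟩
  rintro B A p hp ⟨⟨⟨x⟩, y⟩, hxy⟩
  obtain ⟨z, rfl⟩ := Deformation.exists_map_eq_of_isSurjection hσ hs hpow hp x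
  -- The components in `h_Λ` agree since `Λ → B` is the only homomorphism of `Λ`-algebras.
  refine ⟨ULift.up z, Subtype.ext (Prod.ext rfl (ULift.ext _ _ (CommAlgCat.hom_ext ?_)))⟩
  exact Subsingleton.elim _ _
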